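/- Notation. For a sequence $x=(x(k))_{k\in\mathbb Z}$ let $\hat x(\xi)=\sum_{k\in\mathbb Z}x(k)e^{-2\pi i k\xi}$, let $(Ux)(2m)=x(m)$ and $(Ux)(k)=0$ for odd $k$ (upsampling), let $(T^mx)(k)=x(k-m)$ (translation), and let $(x*y)(k)=\sum_{n}y(n)x(k-n)$ (convolution). For $h,g\in\ell^2(\mathbb Z)$ put $h_0=\delta_0$, $h_j=h*Uh*\cdots*U^{j-1}h$ and $g_j=h_{j-1}*U^{j-1}g$ for $j\ge 1$. The infinitely iterated dyadic filter bank generated by $h$ and $g$ is called stable if $\{T^{2^jk}g_j : j\ge 1,\ k\in\mathbb Z\}$ is a frame for $\ell^2(\mathbb Z)$. Theorem. Let $h,g\in\ell^2(\mathbb Z)$, where $h$ is a low-pass filter ($\hat h(0)=\sqrt2$, $\hat h(\frac12)=0$) and $g$ is a finitely supported high-pass filter ($\hat g(0)=0$). Assume that $$\hat h(\xi)=\sqrt2\left(\frac{1+e^{2\pi i\xi}}{2}\right)^{n}p(\xi),\qquad \xi\in\mathbb R,$$ where $n\ge 1$ is an integer and $p(\xi)=\sum_m c_m e^{-2\pi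 i m\xi}$ (finite sum, $c_m\in\mathbb C$) is a trigonometric polynomial with $p(0)=1$. Suppose that there is an integer $s\ge 1$ with $$\sup_{\xi\in\mathbb R}\left|\prod_{k=0}^{s-1}p(2^k\xi)\right|<2^{(n-\frac12)s},$$ and that the matrix $$M(\xi)=\frac1{\sqrt2}\begin{bmatrix}\hat g(\xi)&\hat h(\xi)\\ \hat g(\xi+\frac12)&\hat h(\xi+\frac12)\end{bmatrix}$$ is expanding, in the sense that $\|M(\xi)c\|\ge\|c\|$ (Euclidean norm) for all $c\in\mathbb C^2$ and almost every $\xi\in[-\frac12,\frac12)$. Then the infinitely iterated dyadic filter bank generated by $h$ and $g$ is stable, with lower frame bound $1$: there is a constant $B<\infty$ such that for all $x\in\ell^2(\mathbb Z)$ $$\|x\|^2\le\sum_{j=1}^{\infty}\sum_{k\in\mathbb Z}\left|\langle x,T^{2^jk}g_j\rangle\right|^2\le B\|x\|^2.$$ -/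

import Mathlib

noncomputable section

namespace FilterBank

/-- The Hilbert space `ℓ²(ℤ)` of square-summable complex sequences. -/
abbrev SqSummable : Type := lp (fun _ : ℤ => ℂ) 2

/-- The Fourier transform `x̂(ξ) = ∑ₙ x(n) e^{-2πinξ}`.  It is only evaluated at finitely supported
sequences, and at sequences whose transform is required to take the value `√2` at `0`; by the
convention for `∑'` the latter are absolutely summable. -/
def fourierTransform (x : ℤ → ℂ) (ξ : ℝ) : ℂ :=
  ∑' n : ℤ, x n * Complex.exp (-2 * Real.pi * Complex.I * n * ξ)

/-- The convolution `(x * y)(k) = ∑ₙ y(n) x(k - n)`. -/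
def conv (x y : ℤ → ℂ) (k : ℤ) : ℂ := ∑' n : ℤ, y n * x (k - n)

/-- The upsampling operator: `(U x)(2m) = x(m)`, and `(U x)(n) = 0` for odd `n`. -/
def upsample (x : ℤ → ℂ) (n : ℤ) : ℂ := if 2 ∣ n then x (n / 2) else 0

/-- The translation `(T^m x)(k) = x(k - m)`. -/
def translate (m : ℤ) (x : ℤ → ℂ) (k : ℤ) : ℂ := x (k - m)

/-- The iterated low-pass filter `h_j = h * U h * ⋯ * U^{j-1} h`; `h_0` is the unit impulse. -/
def iteratedLowPass (h : ℤ → ℂ) : ℕ → ℤ → ℂ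
  | 0 => Pi.single 0 1
  | j + 1 => conv (iteratedLowPass h j) (upsample^[j] h)

/-- The iterated high-pass filter `g_j = h_{j-1} * U^{j-1} g`, for `j ≥ 1`. -/
def iteratedHighPass (h g : ℤ → ℂ) (j : ℕ) : ℤ → ℂ :=
  conv (iteratedLowPass h (j - 1)) (upsample^[j - 1] g)

/-- A low-pass filter: `ĥ(0) = √2` and `ĥ(1/2) = 0`. -/
def IsLowPass (h : ℤ → ℂ) : Prop :=
  fourierTransform h 0 = (Real.sqrt 2 : ℂ) ∧ fourierTransform h (1 / 2) = 0

/-- A high-pass filter: `ĝ(0) = 0`. -/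
def IsHighPass (g : ℤ → ℂ) : Prop := fourierTransform g 0 = 0

/-- Trigonometric polynomials: finite linear combinations of the exponentials `e^{-2πimξ}`,
`m ∈ ℤ`. -/
def IsTrigPolynomial (p : ℝ → ℂ) : Prop :=
  ∃ c : ℤ →₀ ℂ, ∀ ξ : ℝ,
    p ξ = ∑ m ∈ c.support, c m * Complex.exp (-2 * Real.pi * Complex.I * m * ξ)

/-- The modulation matrix of the pair `h`, `g`. -/
def modulationMatrix (h g : ℤ → ℂ) (ξ : ℝ) : Matrix (Fin 2) (Fin 2) ℂ :=
  (1 / (Real.sqrt 2 : ℂ)) •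
    !![fourierTransform g ξ, fourierTransform h ξ;
      fourierTransform g (ξ + 1 / 2), fourierTransform h (ξ + 1 / 2)]

/-- `‖M c‖ ≥ ‖c‖` for all `c ∈ ℂ²`, in the Euclidean norm. -/
def IsExpanding (M : Matrix (Fin 2) (Fin 2) ℂ) : Prop :=
  ∀ c : EuclideanSpace ℂ (Fin 2), ‖c‖ ≤ ‖Matrix.toEuclideanLin M c‖

/-- The family `e` is a frame for the Hilbert space `H` with frame bounds `0 < A ≤ B < ∞`. -/
def IsFrameWithBounds {H J : Type*} [NormedAddCommGroup H] [InnerProductSpace ℂ H]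
    (e : J → H) (A B : ℝ) : Prop :=
  0 < A ∧ A ≤ B ∧ ∀ x : H,
    Summable (fun i => ‖inner ℂ x (e i)‖ ^ 2) ∧
    A * ‖x‖ ^ 2 ≤ ∑' i, ‖inner ℂ x (e i)‖ ^ 2 ∧
    ∑' i, ‖inner ℂ x (e i)‖ ^ 2 ≤ B * ‖x‖ ^ 2

/-- The infinitely iterated dyadic filter bank generated by `h` and `g` is stable, with frame
bounds `A` and `B`: the sequences `T^{2^j k} g_j`, `j = 1, 2, …`, `k ∈ ℤ`, lie in `ℓ²(ℤ)` and form
a frame for `ℓ²(ℤ)` with these bounds.  The index `i = (j, k)` stands for the order `j + 1`. -/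
def IsStableWithBounds (h g : ℤ → ℂ) (A B : ℝ) : Prop :=
  ∃ e : ℕ × ℤ → SqSummable,
    (∀ i : ℕ × ℤ,
      (e i : ℤ → ℂ) = translate (2 ^ (i.1 + 1) * i.2) (iteratedHighPass h g (i.1 + 1))) ∧
    IsFrameWithBounds e A B

end FilterBank

end

/-! Let `S c = h * U c` and `R c = g * U c` be the synthesis operators and `T` the unit translation.
The frame vectors of order `j + 1` are the images of the unit impulses under `S^j R`, so the frame
sum is `∑ⱼ ‖(S^j R)* x‖²`. Everything rests on one estimate, `‖(1 - T) S^j‖ ≤ C ρ^j` with `ρ < 1`.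

Algebraic input: `T` is unitary and `S T = T² S`; the low-pass conditions give `S* S = 1 + Q (1 -
T)`, and the high-pass condition gives `R = (1 - T) W`. With the decay estimate, the first
factorisation makes `S` power bounded (`exists_norm_pow_le`). The second makes `(S^j R)* (S^k R)`
decay like `ρ^|j-k|`, and almost orthogonality yields the upper bound. Also `S*^N → 0` strongly,
since it does so on the dense range of `(1 - T)*`. Expansion of `M(ξ)` passes to its adjoint and
integrates to `‖x‖² ≤ ‖S* x‖² + ‖R* x‖²`; iterating this and discarding the vanishing term `‖S*^N
x‖²` yields the lower bound 1.

The decay is a pointwise bound on `|1 - e^{2πiξ}| ∏ |ĥ(2^k ξ)|` (`exists_norm_one_sub_mul_prod_le`).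
While `2^k ξ` is near the integers, the factor `1 - e^{2πiξ}` is small enough to beat the powers of
`√2`. After that the telescoping product of the `(1 + e^{2πi 2^k ξ})/2` gains `2^{-n}` per step,
which with `√2` and the hypothesis on `p` is a contraction. -/

noncomputable section

namespace FilterBank

/-! ### Abstract Hilbert space argument for iterated operators -/

section IteratedOperators

open Filter Topology

variable {H : Type*} [NormedAddCommGroup H] [InnerProductSpace ℂ H] [CompleteSpace H]

theorem sq_norm_eq_norm_star_mul (A : H →L[ℂ] H) : ‖A‖ ^ 2 = ‖star A * A‖ := by
  rw [CStarRing.norm_star_mul_self, sq]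

/-- If `S*S - 1` factors through `1 - T` and `(1 - T) S ^ j` decays geometrically, then `S` is power
bounded. -/
theorem exists_norm_pow_le (S T Q : H →L[ℂ] H) {C ρ : ℝ} (hC : 0 ≤ C) (hρ : 0 ≤ ρ) (hρ1 : ρ < 1)
    (hdecay : ∀ j, ‖(1 - T) * S ^ j‖ ≤ C * ρ ^ j) (hQ : star S * S = 1 + Q * (1 - T)) :
    ∃ K : ℝ, 0 ≤ K ∧ ∀ j, ‖S ^ j‖ ≤ K := by
  have step : ∀ j, ‖S ^ (j + 1)‖ ≤ ‖S ^ j‖ + ‖Q‖ * C * ρ ^ j := by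
    intro j
    have e : star (S ^ (j + 1)) * S ^ (j + 1)
        = star (S ^ j) * S ^ j + star (S ^ j) * (Q * ((1 - T) * S ^ j)) := by
      have : star (S ^ (j + 1)) * S ^ (j + 1) = star (S ^ j) * (star S * S) * S ^ j := by
        rw [pow_succ' S j, star_mul]; noncomm_ring
      rw [this, hQ]; noncomm_ring
    have h1 : ‖S ^ (j + 1)‖ ^ 2 ≤ ‖S ^ j‖ ^ 2 + ‖S ^ j‖ * (‖Q‖ * (C * ρ ^ j)) := by
      rw [sq_norm_eq_norm_star_mul, e, sq_norm_eq_norm_star_mul (S ^ j)]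
      refine (norm_add_le _ _).trans (add_le_add le_rfl ?_)
      refine (norm_mul_le _ _).trans ?_
      rw [norm_star]
      gcongr
      exact (norm_mul_le _ _).trans (by gcongr; exact hdecay j)
    have h0 : 0 ≤ ‖Q‖ * C * ρ ^ j := by positivity
    -- With `a = ‖S ^ j‖` and `b = ‖Q‖ C ρ ^ j`, this is `a² + a b ≤ (a + b)²`.
    refine le_of_sq_le_sq ?_ (by positivity)
    nlinarith [norm_nonneg (S ^ j)]
  have bound : ∀ j, ‖S ^ j‖ ≤ ‖(1 : H →L[ℂ] H)‖ + ‖Q‖ * C * ∑ i ∈ Finset.range j, ρ ^ i := by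
    intro j
    induction j with
    | zero => simp
    | succ j ih => rw [Finset.sum_range_succ]; linarith [step j]
  refine ⟨‖(1 : H →L[ℂ] H)‖ + ‖Q‖ * C * (1 - ρ)⁻¹,
    by have := inv_nonneg.2 (sub_nonneg.2 hρ1.le); positivity, fun j => (bound j).trans ?_⟩
  gcongr
  rw [← tsum_geometric_of_lt_one hρ hρ1]
  exact (summable_geometric_of_lt_one hρ hρ1).sum_le_tsum _ fun i _ => by positivity

/-- Unitarity of `T` turns `S T = T² S` into `S* T² = T S*`, so `A ↦ S* A S` preserves the commutant
of `T`; iterate from `A = 1`. -/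
theorem commute_star_pow_mul_pow (S T : H →L[ℂ] H) (hT : T * star T = 1) (hT' : star T * T = 1)
    (hST : S * T = T ^ 2 * S) (j : ℕ) : Commute (star (S ^ j) * S ^ j) T := by
  have hS : star S * T ^ 2 = T * star S := by
    have h1 : star T * star S = star S * (star T) ^ 2 := by
      simpa [star_mul, star_pow] using congrArg star hST
    have h2 : (star T) ^ 2 * T ^ 2 = 1 := by
      calc (star T) ^ 2 * T ^ 2 = star T * (star T * T) * T := by noncomm_ring
        _ = 1 := by rw [hT', mul_one, hT']
    calc star S * T ^ 2 = (T * star T) * star S * T ^ 2 := by rw [hT, one_mul]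
      _ = T * (star T * star S) * T ^ 2 := by noncomm_ring
      _ = T * star S * ((star T) ^ 2 * T ^ 2) := by rw [h1]; noncomm_ring
      _ = T * star S := by rw [h2, mul_one]
  have key : ∀ A : H →L[ℂ] H, Commute A T → Commute (star S * A * S) T := by
    intro A hA
    have hA2 : A * T ^ 2 = T ^ 2 * A := (hA.pow_right 2).eq
    show star S * A * S * T = T * (star S * A * S)
    calc star S * A * S * T = star S * A * (S * T) := by noncomm_ring
      _ = star S * (A * T ^ 2) * S := by rw [hST]; noncomm_ring
      _ = (star S * T ^ 2) * A * S := by rw [hA2]; noncomm_ring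
      _ = T * (star S * A * S) := by rw [hS]; noncomm_ring
  induction j with
  | zero => simp
  | succ j ih =>
    have : star (S ^ (j + 1)) * S ^ (j + 1) = star S * (star (S ^ j) * S ^ j) * S := by
      rw [pow_succ S j, star_mul]; noncomm_ring
    rw [this]; exact key _ ih

theorem sum_sum_geometric_le {ρ : ℝ} (hρ : 0 ≤ ρ) (hρ1 : ρ < 1) (N j : ℕ) :
    ∑ k ∈ Finset.range N, ρ ^ (Nat.dist j k) ≤ 2 * (1 - ρ)⁻¹ := by
  have hs := summable_geometric_of_lt_one hρ hρ1
  have hle : ∀ M, ∑ i ∈ Finset.range M, ρ ^ i ≤ (1 - ρ)⁻¹ := fun M => by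
    rw [← tsum_geometric_of_lt_one hρ hρ1]
    exact hs.sum_le_tsum _ fun i _ => by positivity
  have h1 : ∑ k ∈ Finset.range N, ρ ^ (Nat.dist j k)
      ≤ ∑ k ∈ Finset.range (j + 1 + N), ρ ^ (Nat.dist j k) :=
    Finset.sum_le_sum_of_subset_of_nonneg (Finset.range_mono (by omega))
      fun _ _ _ => by positivity
  refine h1.trans ?_
  rw [Finset.sum_range_add, two_mul]
  refine add_le_add ?_ ?_
  · rw [← Finset.sum_range_reflect]
    refine le_trans (le_of_eq (Finset.sum_congr rfl fun k hk => ?_)) (hle (j + 1))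
    have := Finset.mem_range.1 hk
    congr 1
    simp only [Nat.dist]; omega
  · refine le_trans (Finset.sum_le_sum fun k _ => ?_) (hle N)
    refine pow_le_pow_of_le_one hρ hρ1.le ?_
    simp only [Nat.dist]; omega

/-- Almost orthogonal families of operators satisfy a Bessel inequality. -/
theorem sum_sq_norm_star_apply_le (A : ℕ → H →L[ℂ] H) {C ρ : ℝ} (hC : 0 ≤ C) (hρ : 0 ≤ ρ)
    (hρ1 : ρ < 1) (hA : ∀ j k, ‖star (A j) * A k‖ ≤ C * ρ ^ (Nat.dist j k)) (N : ℕ) (x : H) :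
    ∑ j ∈ Finset.range N, ‖star (A j) x‖ ^ 2 ≤ C * (2 * (1 - ρ)⁻¹) * ‖x‖ ^ 2 := by
  set y : ℕ → H := fun j => star (A j) x with hy
  set s : ℝ := ∑ j ∈ Finset.range N, ‖y j‖ ^ 2 with hs
  have hs0 : 0 ≤ s := Finset.sum_nonneg fun _ _ => by positivity
  set B : ℝ := C * (2 * (1 - ρ)⁻¹) with hB
  have hB0 : 0 ≤ B := by have := inv_nonneg.2 (sub_nonneg.2 hρ1.le); positivity
  -- Duality: `s = ⟨x, v⟩ ≤ ‖x‖ ‖v‖`, while almost orthogonality gives `‖v‖² ≤ B s`; one factor `s`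
  -- then cancels.
  set v : H := ∑ j ∈ Finset.range N, A j (y j) with hv
  have inner_star : ∀ (D : H →L[ℂ] H) (a b : H), inner ℂ a (D b) = inner ℂ (star D a) b :=
    fun D a b => (ContinuousLinearMap.adjoint_inner_left D b a).symm
  have hxv : (s : ℂ) = inner ℂ x v := by
    rw [hv, inner_sum, hs]
    push_cast
    refine Finset.sum_congr rfl fun j _ => ?_
    rw [inner_star, inner_self_eq_norm_sq_to_K]; rfl
  have hsx : s ≤ ‖x‖ * ‖v‖ := by
    have := norm_inner_le_norm (𝕜 := ℂ) x v
    rwa [← hxv, Complex.norm_real, Real.norm_of_nonneg hs0] at this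
  have hvv : ‖v‖ ^ 2 ≤ B * s := by
    have h1 : ((‖v‖ ^ 2 : ℝ) : ℂ)
        = ∑ j ∈ Finset.range N, ∑ k ∈ Finset.range N, inner ℂ (y j) ((star (A j) * A k) (y k)) := by
      have : ((‖v‖ ^ 2 : ℝ) : ℂ) = inner ℂ v v := by
        rw [inner_self_eq_norm_sq_to_K]; push_cast; rfl
      rw [this, hv, sum_inner]
      refine Finset.sum_congr rfl fun j _ => ?_
      rw [inner_sum]
      refine Finset.sum_congr rfl fun k _ => ?_
      have := inner_star (star (A j)) (y j) (A k (y k))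
      rw [star_star] at this
      exact this.symm
    have h2 : ‖v‖ ^ 2 ≤ ∑ j ∈ Finset.range N, ∑ k ∈ Finset.range N,
        C * ρ ^ (Nat.dist j k) * ((‖y j‖ ^ 2 + ‖y k‖ ^ 2) / 2) := by
      have h3 := congrArg norm h1
      rw [Complex.norm_real, Real.norm_of_nonneg (by positivity)] at h3
      rw [h3]
      refine (norm_sum_le _ _).trans (Finset.sum_le_sum fun j _ => ?_)
      refine (norm_sum_le _ _).trans (Finset.sum_le_sum fun k _ => ?_)
      refine (norm_inner_le_norm _ _).trans ?_
      have h4 := (star (A j) * A k).le_of_opNorm_le (hA j k) (y k)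
      have h5 : 0 ≤ C * ρ ^ (Nat.dist j k) := by positivity
      calc ‖y j‖ * ‖(star (A j) * A k) (y k)‖
          ≤ ‖y j‖ * (C * ρ ^ (Nat.dist j k) * ‖y k‖) := by gcongr
        _ = C * ρ ^ (Nat.dist j k) * (‖y j‖ * ‖y k‖) := by ring
        _ ≤ _ := by
          refine mul_le_mul_of_nonneg_left ?_ h5
          nlinarith [sq_nonneg (‖y j‖ - ‖y k‖)]
    have h6 : ∑ j ∈ Finset.range N, ∑ k ∈ Finset.range N,
        C * ρ ^ (Nat.dist j k) * (‖y j‖ ^ 2 / 2) ≤ B * s / 2 := by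
      have : B * s / 2 = ∑ j ∈ Finset.range N, B * (‖y j‖ ^ 2 / 2) := by
        rw [hs, ← Finset.mul_sum, ← Finset.sum_div]; ring
      rw [this]
      refine Finset.sum_le_sum fun j _ => ?_
      rw [← Finset.sum_mul, ← Finset.mul_sum]
      gcongr
      exact mul_le_mul_of_nonneg_left (sum_sum_geometric_le hρ hρ1 N j) hC
    have h7 : ∑ j ∈ Finset.range N, ∑ k ∈ Finset.range N,
        C * ρ ^ (Nat.dist j k) * (‖y k‖ ^ 2 / 2) ≤ B * s / 2 := by
      rw [Finset.sum_comm]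
      simpa only [Nat.dist_comm] using h6
    refine h2.trans ?_
    have h8 : ∑ j ∈ Finset.range N, ∑ k ∈ Finset.range N,
        C * ρ ^ (Nat.dist j k) * ((‖y j‖ ^ 2 + ‖y k‖ ^ 2) / 2)
        = ∑ j ∈ Finset.range N, ∑ k ∈ Finset.range N, C * ρ ^ (Nat.dist j k) * (‖y j‖ ^ 2 / 2)
        + ∑ j ∈ Finset.range N, ∑ k ∈ Finset.range N,
          C * ρ ^ (Nat.dist j k) * (‖y k‖ ^ 2 / 2) := by
      simp only [← Finset.sum_add_distrib]
      refine Finset.sum_congr rfl fun j _ => Finset.sum_congr rfl fun k _ => by ring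
    linarith
  show s ≤ B * ‖x‖ ^ 2
  rcases hs0.eq_or_lt with h0 | h0
  · rw [← h0]; positivity
  · have h1 : s ^ 2 ≤ ‖x‖ ^ 2 * (B * s) := by
      calc s ^ 2 ≤ (‖x‖ * ‖v‖) ^ 2 := by gcongr
        _ = ‖x‖ ^ 2 * ‖v‖ ^ 2 := by ring
        _ ≤ _ := by gcongr
    have h2 : s * s ≤ (B * ‖x‖ ^ 2) * s := by nlinarith
    exact le_of_mul_le_mul_right h2 h0

/-- The decay of the cross terms between scales. -/
theorem norm_star_pow_mul_mul_pow_mul_le (S R T W : H →L[ℂ] H) {C ρ K : ℝ}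
    (hT : T * star T = 1) (hT' : star T * T = 1) (hST : S * T = T ^ 2 * S)
    (hW : R = (1 - T) * W) (hK : ∀ j, ‖S ^ j‖ ≤ K)
    (hdecay : ∀ j, ‖(1 - T) * S ^ j‖ ≤ C * ρ ^ j) (j k : ℕ) :
    ‖star (S ^ j * R) * (S ^ k * R)‖ ≤ ‖W‖ * K ^ 2 * ‖star T‖ * C * ‖R‖ * ρ ^ (Nat.dist j k) := by
  have main : ∀ j m, ‖star (S ^ j * R) * (S ^ (j + m) * R)‖
      ≤ ‖W‖ * K ^ 2 * ‖star T‖ * C * ‖R‖ * ρ ^ m := by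
    intro j m
    set P := star (S ^ j) * S ^ j with hP
    have hcomm : P * star T = star T * P := by
      have := congrArg star (commute_star_pow_mul_pow S T hT hT' hST j).eq
      simp only [star_mul, star_star] at this
      exact this.symm
    -- The factor `(1 - T)*` coming from `R*` commutes past `P` and, by unitarity, becomes a
    -- multiple of `1 - T` standing directly left of `S ^ m`, where the decay applies.
    have e1 : star (1 - T) = -(star T * (1 - T)) := by
      rw [mul_sub, mul_one, hT', star_sub, star_one]; abel
    have hRs : star R = star W * star (1 - T) := by rw [hW, star_mul]
    have hP1 : star (1 - T) * P = P * star (1 - T) := by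
      rw [star_sub, star_one, sub_mul, mul_sub, hcomm, one_mul, mul_one]
    have e : star (S ^ j * R) * (S ^ (j + m) * R)
        = -(star W * P * star T * ((1 - T) * S ^ m) * R) := by
      calc star (S ^ j * R) * (S ^ (j + m) * R) = star R * P * S ^ m * R := by
            rw [star_mul, pow_add, hP]; simp only [mul_assoc]
        _ = star W * (star (1 - T) * P) * S ^ m * R := by rw [hRs]; simp only [mul_assoc]
        _ = star W * (P * star (1 - T)) * S ^ m * R := by rw [hP1]
        _ = star W * (P * -(star T * (1 - T))) * S ^ m * R := by rw [e1]
        _ = _ := by simp only [mul_neg, neg_mul, mul_assoc]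
    have hPn : ‖P‖ ≤ K ^ 2 := by
      rw [hP, ← sq_norm_eq_norm_star_mul]
      exact pow_le_pow_left₀ (norm_nonneg _) (hK j) 2
    rw [e, norm_neg]
    calc ‖star W * P * star T * ((1 - T) * S ^ m) * R‖
        ≤ ‖star W‖ * ‖P‖ * ‖star T‖ * ‖(1 - T) * S ^ m‖ * ‖R‖ := by
          refine (norm_mul_le _ _).trans (mul_le_mul_of_nonneg_right ?_ (norm_nonneg _))
          refine (norm_mul_le _ _).trans (mul_le_mul_of_nonneg_right ?_ (norm_nonneg _))
          refine (norm_mul_le _ _).trans (mul_le_mul_of_nonneg_right ?_ (norm_nonneg _))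
          exact norm_mul_le _ _
      _ ≤ ‖W‖ * K ^ 2 * ‖star T‖ * (C * ρ ^ m) * ‖R‖ := by
          rw [norm_star W]
          gcongr
          exact hdecay m
      _ = _ := by ring
  rcases le_total j k with h | h
  · obtain ⟨m, rfl⟩ := Nat.exists_eq_add_of_le h
    convert main j m using 2
    simp [Nat.dist]
  · obtain ⟨m, rfl⟩ := Nat.exists_eq_add_of_le h
    rw [← norm_star, star_mul, star_star]
    convert main k m using 2
    simp [Nat.dist]

/-- The iterated analysis operators `S* ^ j` tend strongly to zero. -/
theorem tendsto_star_pow_apply (S T : H →L[ℂ] H) {C ρ K : ℝ}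
    (hρ : 0 ≤ ρ) (hρ1 : ρ < 1) (hK : ∀ j, ‖S ^ j‖ ≤ K)
    (hdecay : ∀ j, ‖(1 - T) * S ^ j‖ ≤ C * ρ ^ j) (hker : ∀ x, T x = x → x = 0) (x : H) :
    Tendsto (fun j => star (S ^ j) x) atTop (𝓝 0) := by
  have hK0 : 0 ≤ K := (norm_nonneg _).trans (hK 0)
  -- The orthogonal complement of the range of `(1 - T)*` is the kernel of `1 - T`, which is
  -- trivial.
  have hdense : Dense (Set.range (star (1 - T) : H →L[ℂ] H)) := by
    have h1 : (star (1 - T) : H →L[ℂ] H).rangeᗮ = ⊥ := by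
      rw [ContinuousLinearMap.star_eq_adjoint, ContinuousLinearMap.orthogonal_range,
        ContinuousLinearMap.adjoint_adjoint]
      rw [eq_bot_iff]
      intro y hy
      have : y - T y = 0 := by simpa using hy
      exact hker y (sub_eq_zero.1 this).symm
    have := Submodule.dense_iff_topologicalClosure_eq_top.2
      ((Submodule.topologicalClosure_eq_top_iff).2 h1)
    exact this
  rw [Metric.tendsto_atTop]
  intro ε hε
  obtain ⟨_, hy, ⟨y, rfl⟩⟩ := Metric.dense_iff.1 hdense x (ε / (2 * (K + 1))) (by positivity)
  have hlim : Tendsto (fun j : ℕ => C * ρ ^ j * ‖y‖) atTop (𝓝 0) := by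
    simpa using ((tendsto_pow_atTop_nhds_zero_of_lt_one hρ hρ1).const_mul C).mul_const ‖y‖
  obtain ⟨N, hN⟩ := Metric.tendsto_atTop.1 hlim (ε / 2) (by positivity)
  refine ⟨N, fun j hj => ?_⟩
  rw [dist_zero_right]
  have h1 : ‖star (S ^ j) (star (1 - T) y)‖ ≤ C * ρ ^ j * ‖y‖ := by
    have : star (S ^ j) (star (1 - T) y) = star ((1 - T) * S ^ j) y := by
      rw [star_mul]; rfl
    rw [this]
    exact (star ((1 - T) * S ^ j)).le_of_opNorm_le (by rw [norm_star]; exact hdecay j) y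
  have h2 : ‖star (S ^ j) (x - star (1 - T) y)‖ ≤ K * (ε / (2 * (K + 1))) := by
    have hj : ‖star (S ^ j)‖ ≤ K := by rw [norm_star]; exact hK j
    refine ((star (S ^ j)).le_of_opNorm_le hj _).trans ?_
    gcongr
    have := Metric.mem_ball.1 hy
    rw [dist_comm, dist_eq_norm] at this
    exact this.le
  have h3 : C * ρ ^ j * ‖y‖ < ε / 2 := by
    have := hN j hj
    rw [Real.dist_eq, sub_zero] at this
    exact (le_abs_self _).trans_lt this
  have h4 : K * (ε / (2 * (K + 1))) ≤ ε / 2 := by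
    rw [mul_div_assoc', div_le_div_iff₀ (by positivity) (by positivity)]
    nlinarith
  calc ‖star (S ^ j) x‖ = ‖star (S ^ j) (x - star (1 - T) y) + star (S ^ j) (star (1 - T) y)‖ := by
        rw [← map_add, sub_add_cancel]
    _ ≤ _ := norm_add_le _ _
    _ < ε := by linarith

/-- Lower and upper frame inequalities for the iterated analysis operators. -/
theorem exists_iterated_frame_bounds (S R T Q W : H →L[ℂ] H) {C ρ : ℝ} (hC : 0 ≤ C) (hρ : 0 ≤ ρ)
    (hρ1 : ρ < 1) (hT : T * star T = 1) (hT' : star T * T = 1) (hST : S * T = T ^ 2 * S)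
    (hQ : star S * S = 1 + Q * (1 - T)) (hW : R = (1 - T) * W)
    (hdecay : ∀ j, ‖(1 - T) * S ^ j‖ ≤ C * ρ ^ j) (hker : ∀ x, T x = x → x = 0)
    (hexp : ∀ x, ‖x‖ ^ 2 ≤ ‖star S x‖ ^ 2 + ‖star R x‖ ^ 2) :
    ∃ B : ℝ, 1 ≤ B ∧ ∀ x : H, Summable (fun j : ℕ => ‖star (S ^ j * R) x‖ ^ 2) ∧
      ‖x‖ ^ 2 ≤ ∑' j : ℕ, ‖star (S ^ j * R) x‖ ^ 2 ∧
      ∑' j : ℕ, ‖star (S ^ j * R) x‖ ^ 2 ≤ B * ‖x‖ ^ 2 := by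
  obtain ⟨K, hK0, hK⟩ := exists_norm_pow_le S T Q hC hρ hρ1 hdecay hQ
  set C' := ‖W‖ * K ^ 2 * ‖star T‖ * C * ‖R‖ with hC'
  refine ⟨max 1 (C' * (2 * (1 - ρ)⁻¹)), le_max_left _ _, fun x => ?_⟩
  have hub : ∀ N, ∑ j ∈ Finset.range N, ‖star (S ^ j * R) x‖ ^ 2
      ≤ max 1 (C' * (2 * (1 - ρ)⁻¹)) * ‖x‖ ^ 2 := fun N =>
    (sum_sq_norm_star_apply_le (fun j => S ^ j * R) (by positivity) hρ hρ1
      (norm_star_pow_mul_mul_pow_mul_le S R T W hT hT' hST hW hK hdecay) N x).trans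
      (by gcongr; exact le_max_right _ _)
  have hsum : Summable (fun j : ℕ => ‖star (S ^ j * R) x‖ ^ 2) :=
    summable_of_sum_range_le (fun _ => by positivity) hub
  refine ⟨hsum, ?_, hsum.tsum_le_of_sum_range_le hub⟩
  -- The one-step inequality applied to `S*^N x` splits the remainder into the next remainder and
  -- the term of index `N`.
  have hpart : ∀ N, ‖x‖ ^ 2 ≤ ‖star (S ^ N) x‖ ^ 2
      + ∑ j ∈ Finset.range N, ‖star (S ^ j * R) x‖ ^ 2 := by
    intro N
    induction N with
    | zero => simp
    | succ N ih =>
      have h1 := hexp (star (S ^ N) x)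
      have h2 : star S (star (S ^ N) x) = star (S ^ (N + 1)) x := by
        rw [pow_succ, star_mul]; rfl
      have h3 : star R (star (S ^ N) x) = star (S ^ N * R) x := by rw [star_mul]; rfl
      rw [h2, h3] at h1
      rw [Finset.sum_range_succ]
      linarith
  have hlim : Tendsto (fun N => ‖star (S ^ N) x‖ ^ 2
      + ∑ j ∈ Finset.range N, ‖star (S ^ j * R) x‖ ^ 2) atTop
      (𝓝 (0 + ∑' j : ℕ, ‖star (S ^ j * R) x‖ ^ 2)) := by
    refine Tendsto.add ?_ hsum.hasSum.tendsto_sum_nat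
    have := ((tendsto_star_pow_apply S T hρ hρ1 hK hdecay hker x).norm).pow 2
    simpa using this
  rw [zero_add] at hlim
  exact ge_of_tendsto' hlim hpart

end IteratedOperators

/-! ### Pointwise decay of the dyadic products -/

section Decay

/-- A dyadic product of `q` that contracts over `s` steps decays geometrically. -/
theorem exists_norm_prod_le_geometric (q : ℝ → ℂ) {K θ : ℝ} (hK : ∀ ξ, ‖q ξ‖ ≤ K) (hθ : θ < 1)
    {s : ℕ} (hs : 1 ≤ s) (hq : ∀ ξ, ‖∏ k ∈ Finset.range s, q (2 ^ k * ξ)‖ ≤ θ) :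
    ∃ C ρ : ℝ, 0 ≤ C ∧ 0 < ρ ∧ ρ < 1 ∧
      ∀ m ξ, ‖∏ k ∈ Finset.range m, q (2 ^ k * ξ)‖ ≤ C * ρ ^ m := by
  have hθ0 : 0 ≤ θ := (norm_nonneg _).trans (hq 0)
  obtain ⟨ρ, hρ0, hρ1, hρs⟩ : ∃ ρ : ℝ, 0 < ρ ∧ ρ < 1 ∧ θ ≤ ρ ^ s := by
    -- The midpoint stays positive when `θ = 0` and below 1; `ρ` is its `s`-th root.
    set η := (θ + 1) / 2 with hη
    have h0 : 0 < η := by positivity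
    refine ⟨η ^ ((s : ℝ)⁻¹), by positivity,
      Real.rpow_lt_one h0.le (by linarith) (by positivity), ?_⟩
    rw [Real.rpow_inv_natCast_pow h0.le (by omega)]
    linarith
  set L := max K 1 with hL
  have hL1 : 1 ≤ L := le_max_right _ _
  have hCρ : L ^ s / ρ ^ s * ρ ^ s = L ^ s := by field_simp
  refine ⟨L ^ s / ρ ^ s, ρ, by positivity, hρ0, hρ1, fun m => ?_⟩
  induction m using Nat.strong_induction_on with
  | _ m ih =>
    intro ξ
    rcases lt_or_ge m s with h | h
    · calc ‖∏ k ∈ Finset.range m, q (2 ^ k * ξ)‖ ≤ ∏ k ∈ Finset.range m, L := by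
            rw [norm_prod]
            exact Finset.prod_le_prod (fun _ _ => norm_nonneg _)
              fun k _ => (hK _).trans (le_max_left _ _)
        _ = L ^ m := by simp
        _ ≤ L ^ s := pow_le_pow_right₀ hL1 h.le
        _ = L ^ s / ρ ^ s * ρ ^ s := hCρ.symm
        _ ≤ _ := mul_le_mul_of_nonneg_left (pow_le_pow_of_le_one hρ0.le hρ1.le h.le) (by positivity)
    · obtain ⟨r, rfl⟩ := Nat.exists_eq_add_of_le h
      rw [Finset.prod_range_add, norm_mul]
      have e : ∏ k ∈ Finset.range r, q (2 ^ (s + k) * ξ)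
          = ∏ k ∈ Finset.range r, q (2 ^ k * (2 ^ s * ξ)) :=
        Finset.prod_congr rfl fun k _ => by rw [pow_add]; ring_nf
      rw [e]
      calc _ ≤ ρ ^ s * (L ^ s / ρ ^ s * ρ ^ r) := by
            gcongr
            · exact (hq ξ).trans hρs
            · exact ih r (by omega) _
        _ = _ := by rw [pow_add]; ring

/-- The exponential `e^{2πiξ}`. -/
def unitExp (ξ : ℝ) : ℂ := Complex.exp (2 * Real.pi * Complex.I * ξ)

theorem norm_unitExp (ξ : ℝ) : ‖unitExp ξ‖ = 1 := by
  have : (2 * Real.pi * Complex.I * ξ : ℂ) = ((2 * Real.pi * ξ : ℝ) : ℂ) * Complex.I := by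
    push_cast; ring
  rw [unitExp, this, Complex.norm_exp_ofReal_mul_I]

theorem unitExp_two_mul (ξ : ℝ) : unitExp (2 * ξ) = unitExp ξ ^ 2 := by
  rw [unitExp, unitExp, ← Complex.exp_nat_mul]
  congr 1; push_cast; ring

theorem norm_one_sub_unitExp_two_pow_mul_le (j : ℕ) (ξ : ℝ) :
    ‖1 - unitExp (2 ^ j * ξ)‖ ≤ 2 ^ j * ‖1 - unitExp ξ‖ := by
  induction j with
  | zero => simp
  | succ j ih =>
    have e : (2 : ℝ) ^ (j + 1) * ξ = 2 * (2 ^ j * ξ) := by ring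
    have e2 : 1 - unitExp (2 ^ j * ξ) ^ 2
        = (1 - unitExp (2 ^ j * ξ)) * (1 + unitExp (2 ^ j * ξ)) := by ring
    rw [e, unitExp_two_mul, e2, norm_mul]
    have : ‖1 + unitExp (2 ^ j * ξ)‖ ≤ 2 := by
      refine (norm_add_le _ _).trans ?_
      rw [norm_unitExp]; norm_num
    calc _ ≤ (2 ^ j * ‖1 - unitExp ξ‖) * 2 := by gcongr
      _ = _ := by ring

/-- The telescoping identity behind `∏ cos (2 ^ k ξ) = sin (2 ^ m ξ) / (2 ^ m sin ξ)`. -/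
theorem prod_one_add_unitExp_mul (m : ℕ) (ξ : ℝ) :
    (∏ k ∈ Finset.range m, (1 + unitExp (2 ^ k * ξ)) / 2) * (1 - unitExp ξ) * 2 ^ m
      = 1 - unitExp (2 ^ m * ξ) := by
  induction m with
  | zero => simp
  | succ m ih =>
    have e : (2 : ℝ) ^ (m + 1) * ξ = 2 * (2 ^ m * ξ) := by ring
    rw [Finset.prod_range_succ, e, unitExp_two_mul]
    linear_combination (1 + unitExp (2 ^ m * ξ)) * ih

/-- The decay estimate for the iterated low-pass filter in the Fourier domain. -/
theorem exists_norm_one_sub_mul_prod_le (p : ℝ → ℂ) {A K : ℝ} (hA : 0 ≤ A)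
    (hp1 : ∀ ξ, ‖p ξ‖ ≤ 1 + A * ‖1 - unitExp ξ‖) (hK : ∀ ξ, ‖p ξ‖ ≤ K)
    {n s : ℕ} (hs : 1 ≤ s) {θ : ℝ} (hθ : θ < (2 : ℝ) ^ (((n : ℝ) - 1 / 2) * s))
    (hp : ∀ ξ, ‖∏ k ∈ Finset.range s, p (2 ^ k * ξ)‖ ≤ θ) :
    ∃ C ρ : ℝ, 0 ≤ C ∧ 0 ≤ ρ ∧ ρ < 1 ∧ ∀ (m : ℕ) (ξ : ℝ),
      ‖1 - unitExp ξ‖ * ‖∏ k ∈ Finset.range m,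
        ((Real.sqrt 2 : ℂ) * ((1 + unitExp (2 ^ k * ξ)) / 2) ^ n * p (2 ^ k * ξ))‖ ≤ C * ρ ^ m := by
  set r : ℝ := √2 with hr
  have hr0 : 0 < r := by positivity
  have hr2 : r ^ 2 = 2 := Real.sq_sqrt (by norm_num)
  -- the normalised factor contracts over `s` steps
  set q : ℝ → ℂ := fun ξ => ((r / 2 ^ n : ℝ) : ℂ) * p ξ with hq
  have hc0 : 0 < r / 2 ^ n := by positivity
  obtain ⟨C₁, ρ₁, hC₁, hρ₁0, hρ₁1, hdec⟩ : ∃ C ρ : ℝ, 0 ≤ C ∧ 0 < ρ ∧ ρ < 1 ∧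
      ∀ m ξ, ‖∏ k ∈ Finset.range m, q (2 ^ k * ξ)‖ ≤ C * ρ ^ m := by
    refine exists_norm_prod_le_geometric q (K := r / 2 ^ n * K) (θ := (r / 2 ^ n) ^ s * θ)
      (fun ξ => ?_) ?_ hs (fun ξ => ?_)
    · rw [hq, norm_mul, Complex.norm_real, Real.norm_of_nonneg hc0.le]
      gcongr; exact hK ξ
    -- The exponent in the hypothesis on `p` is exactly what makes `(√2 / 2 ^ n) ^ s * θ < 1`.
    · have h1 : r / 2 ^ n = (2 : ℝ) ^ (-((n : ℝ) - 1 / 2)) := by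
        rw [hr, Real.sqrt_eq_rpow, ← Real.rpow_natCast, ← Real.rpow_sub (by norm_num)]
        congr 1; ring
      have h2 : (r / 2 ^ n) ^ s = ((2 : ℝ) ^ (((n : ℝ) - 1 / 2) * s))⁻¹ := by
        rw [h1, ← Real.rpow_natCast, ← Real.rpow_mul (by norm_num), ← Real.rpow_neg (by norm_num)]
        congr 1; ring
      rw [h2, inv_mul_lt_iff₀ (by positivity), mul_one]
      exact hθ
    · rw [hq, Finset.prod_mul_distrib, norm_mul, Finset.prod_const, Finset.card_range, norm_pow,
        Complex.norm_real, Real.norm_of_nonneg hc0.le]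
      gcongr; exact hp ξ
  -- The rate `1/√2` comes from the scales near the integers, `ρ₁` from the remaining ones.
  set ρ := max r⁻¹ ρ₁ with hρ
  have hr1 : r⁻¹ < 1 := inv_lt_one_of_one_lt₀ (by nlinarith)
  have hρ0 : 0 ≤ ρ := hρ₁0.le.trans (le_max_right _ _)
  have hρ1 : ρ < 1 := max_lt hr1 hρ₁1
  refine ⟨2 * 2 ^ n * Real.exp A ^ 2 * C₁, ρ, by positivity, hρ0, hρ1, fun m ξ => ?_⟩
  set d := ‖1 - unitExp ξ‖ with hd
  have hd0 : 0 ≤ d := norm_nonneg _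
  have hd2 : d ≤ 2 := by
    refine (norm_sub_le _ _).trans ?_
    rw [norm_unitExp]; norm_num
  set b : ℝ → ℂ := fun ξ => (1 + unitExp ξ) / 2 with hb
  set β : ℝ := ‖∏ k ∈ Finset.range m, b (2 ^ k * ξ)‖ with hβ
  have hb1 : ∀ ξ, ‖b ξ‖ ≤ 1 := fun ξ => by
    have h := norm_add_le (1 : ℂ) (unitExp ξ)
    rw [norm_unitExp, norm_one] at h
    rw [hb, norm_div, Complex.norm_ofNat]
    linarith
  have hβ0 : 0 ≤ β := norm_nonneg _
  have hβ1 : β ≤ 1 := by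
    rw [hβ, norm_prod]
    exact Finset.prod_le_one (fun _ _ => norm_nonneg _) fun _ _ => hb1 _
  have hβd : β * d * 2 ^ m ≤ 2 := by
    have h := congrArg norm (prod_one_add_unitExp_mul m ξ)
    rw [norm_mul, norm_mul, norm_pow, Complex.norm_ofNat] at h
    change β * d * 2 ^ m = _ at h
    rw [h]
    refine (norm_sub_le _ _).trans ?_
    rw [norm_unitExp]; norm_num
  -- Each factor is at most `exp (A 2^k d)`, and the exponents sum to at most `A d 2^j ≤ 2 A`.
  have hlow : ∀ j, d * 2 ^ j ≤ 2 → ‖∏ k ∈ Finset.range j, p (2 ^ k * ξ)‖ ≤ Real.exp A ^ 2 := by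
    intro j hj
    calc ‖∏ k ∈ Finset.range j, p (2 ^ k * ξ)‖
        ≤ ∏ k ∈ Finset.range j, Real.exp (A * (2 ^ k * d)) := by
          rw [norm_prod]
          refine Finset.prod_le_prod (fun _ _ => norm_nonneg _) fun k _ => (hp1 _).trans ?_
          have h1 := norm_one_sub_unitExp_two_pow_mul_le k ξ
          have h2 := Real.add_one_le_exp (A * (2 ^ k * d))
          have h3 := mul_le_mul_of_nonneg_left h1 hA
          linarith
      _ = Real.exp (A * (d * ∑ k ∈ Finset.range j, (2 : ℝ) ^ k)) := by
          rw [← Real.exp_sum, Finset.mul_sum, Finset.mul_sum]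
          congr 1
          exact Finset.sum_congr rfl fun k _ => by ring
      _ ≤ Real.exp (A * 2) := by
          refine Real.exp_le_exp.2 (mul_le_mul_of_nonneg_left (le_trans ?_ hj) hA)
          refine mul_le_mul_of_nonneg_left ?_ hd0
          rw [geom_sum_eq (by norm_num)]
          norm_num
      _ = _ := by rw [← Real.exp_nat_mul]; push_cast; ring_nf
  -- split the product at the scale where `2 ^ j * ξ` leaves a neighbourhood of the integers
  obtain ⟨j, l, rfl, hj, hl⟩ : ∃ j l, m = j + l ∧ d * 2 ^ j ≤ 2 ∧ (l = 0 ∨ 1 < d * 2 ^ j) := by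
    clear hβ hβ0 hβ1 hβd β
    induction m with
    | zero => exact ⟨0, 0, rfl, by simpa using hd2, Or.inl rfl⟩
    | succ m ih =>
      obtain ⟨j, l, rfl, hj, rfl | hl⟩ := ih
      · rcases le_or_gt (d * 2 ^ (j + 1)) 2 with h | h
        · exact ⟨j + 1, 0, by omega, h, Or.inl rfl⟩
        · exact ⟨j, 1, by omega, hj, Or.inr (by rw [pow_succ] at h; linarith)⟩
      · exact ⟨j, l + 1, by omega, hj, Or.inr hl⟩
  -- When `l > 0`, the factor `d 2^j > 1` may be dropped from `β d 2^(j+l) ≤ 2`.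
  have hβl : β * 2 ^ l ≤ 2 := by
    rcases hl with rfl | hl
    · simpa using hβ1.trans (by norm_num : (1 : ℝ) ≤ 2)
    · refine le_trans ?_ hβd
      rw [pow_add]
      have : 0 ≤ β * 2 ^ l := by positivity
      nlinarith
  set Pj := ‖∏ k ∈ Finset.range j, p (2 ^ k * ξ)‖ with hPj
  set Pl := ‖∏ k ∈ Finset.range l, p (2 ^ k * (2 ^ j * ξ))‖ with hPl
  have hPl' : (r / 2 ^ n) ^ l * Pl ≤ C₁ * ρ₁ ^ l := by
    have := hdec l (2 ^ j * ξ)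
    rwa [hq, Finset.prod_mul_distrib, norm_mul, Finset.prod_const, Finset.card_range, norm_pow,
      Complex.norm_real, Real.norm_of_nonneg hc0.le] at this
  have hsplit : ‖∏ k ∈ Finset.range (j + l),
      ((r : ℂ) * ((1 + unitExp (2 ^ k * ξ)) / 2) ^ n * p (2 ^ k * ξ))‖
      = r ^ (j + l) * β ^ n * (Pj * Pl) := by
    have e : ∏ k ∈ Finset.range l, p (2 ^ (j + k) * ξ)
        = ∏ k ∈ Finset.range l, p (2 ^ k * (2 ^ j * ξ)) :=
      Finset.prod_congr rfl fun k _ => by rw [pow_add]; ring_nf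
    rw [Finset.prod_mul_distrib, Finset.prod_mul_distrib, Finset.prod_pow, Finset.prod_const,
      Finset.card_range, Finset.prod_range_add (fun k => p (2 ^ k * ξ)), e, norm_mul, norm_mul,
      norm_mul, norm_pow, norm_pow, Complex.norm_real, Real.norm_of_nonneg hr0.le]
  have hdr : d * r ^ j ≤ 2 * r⁻¹ ^ j := by
    have h2 : (2 : ℝ) ^ j = r ^ j * r ^ j := by rw [← mul_pow, ← sq, hr2]
    rw [inv_pow, ← div_eq_mul_inv, le_div_iff₀ (by positivity), mul_assoc, ← h2]
    exact hj
  have hβn : β ^ n * (2 ^ n) ^ l ≤ 2 ^ n := by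
    rw [← pow_mul, mul_comm n l, pow_mul, ← mul_pow]
    exact pow_le_pow_left₀ (by positivity) hβl n
  rw [hsplit]
  have hrl : r ^ l = (2 ^ n) ^ l * (r / 2 ^ n) ^ l := by
    rw [← mul_pow]; congr 1; field_simp
  calc d * (r ^ (j + l) * β ^ n * (Pj * Pl))
      = (d * r ^ j) * (β ^ n * (2 ^ n) ^ l) * Pj * ((r / 2 ^ n) ^ l * Pl) := by
        rw [pow_add, hrl]; ring
    _ ≤ (2 * r⁻¹ ^ j) * 2 ^ n * Real.exp A ^ 2 * (C₁ * ρ₁ ^ l) := by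
        gcongr
        exact hlow j hj
    _ ≤ (2 * ρ ^ j) * 2 ^ n * Real.exp A ^ 2 * (C₁ * ρ ^ l) := by
        gcongr
        · exact le_max_left _ _
        · exact le_max_right _ _
    _ = _ := by rw [pow_add]; ring

end Decay

/-! ### Laurent polynomials acting on `ℓ²(ℤ)` and their symbols -/

section LaurentOperators

open ComplexConjugate

/-- Finitely supported sequences, as Laurent polynomials. -/
abbrev Filt : Type := AddMonoidAlgebra ℂ ℤ

/-- The unit impulse at `k`. -/
def impulse (k : ℤ) : SqSummable := lp.single 2 k 1

theorem orthonormal_impulse : Orthonormal ℂ impulse := by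
  rw [orthonormal_iff_ite]
  intro i j
  rw [impulse, impulse, lp.inner_single_left, lp.single_apply, Pi.single_apply]
  simp

theorem inner_impulse_left (k : ℤ) (x : SqSummable) : inner ℂ (impulse k) x = x k := by
  simp [impulse, lp.inner_single_left]

theorem single_eq_smul_impulse (k : ℤ) (c : ℂ) :
    (lp.single 2 k c : SqSummable) = c • impulse k := by
  rw [impulse, ← lp.single_smul, smul_eq_mul, mul_one]

theorem ext_impulse {A B : SqSummable →L[ℂ] SqSummable}
    (h : ∀ k, A (impulse k) = B (impulse k)) : A = B := by
  refine lp.ext_continuousLinearMap (by norm_num) fun i => ?_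
  ext1
  simpa [impulse] using h i

/-- The isometry of `ℓ²(ℤ)` that moves the impulse at `k` to `φ k`. -/
def reindex (φ : ℤ → ℤ) (hφ : Function.Injective φ) : SqSummable →L[ℂ] SqSummable :=
  ((orthonormal_impulse.comp φ hφ).orthogonalFamily.linearIsometry).toContinuousLinearMap

theorem reindex_impulse (φ : ℤ → ℤ) (hφ : Function.Injective φ) (k : ℤ) :
    reindex φ hφ (impulse k) = impulse (φ k) := by
  simp [reindex, impulse]

theorem norm_reindex (φ : ℤ → ℤ) (hφ : Function.Injective φ) (x : SqSummable) :
    ‖reindex φ hφ x‖ = ‖x‖ :=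
  LinearIsometry.norm_map _ x

theorem star_reindex_mul_reindex (φ : ℤ → ℤ) (hφ : Function.Injective φ) :
    star (reindex φ hφ) * reindex φ hφ = 1 := by
  rw [ContinuousLinearMap.star_eq_adjoint]
  exact (ContinuousLinearMap.norm_map_iff_adjoint_comp_self _).1 (norm_reindex φ hφ)

theorem star_reindex_apply (φ : ℤ → ℤ) (hφ : Function.Injective φ) (x : SqSummable) (k : ℤ) :
    star (reindex φ hφ) x k = x (φ k) := by
  rw [← inner_impulse_left, ContinuousLinearMap.star_eq_adjoint,
    ContinuousLinearMap.adjoint_inner_right, reindex_impulse, inner_impulse_left]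

/-- Translation by `m` on `ℓ²(ℤ)`. -/
def shiftOp (m : ℤ) : SqSummable →L[ℂ] SqSummable := reindex (m + ·) (add_right_injective m)

/-- Upsampling on `ℓ²(ℤ)`. -/
def upOp : SqSummable →L[ℂ] SqSummable :=
  reindex (2 * ·) (mul_right_injective₀ (by norm_num : (2 : ℤ) ≠ 0))

theorem shiftOp_impulse (m k : ℤ) : shiftOp m (impulse k) = impulse (m + k) := reindex_impulse _ _ _

theorem upOp_impulse (k : ℤ) : upOp (impulse k) = impulse (2 * k) := reindex_impulse _ _ _

theorem norm_upOp_le : ‖upOp‖ ≤ 1 :=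
  upOp.opNorm_le_bound zero_le_one fun x => by rw [one_mul]; exact (norm_reindex _ _ x).le

theorem shiftOp_add (m k : ℤ) : shiftOp (m + k) = shiftOp m * shiftOp k :=
  ext_impulse fun i => by
    rw [mul_apply_eq_comp]
    simp only [shiftOp_impulse, add_assoc]

theorem shiftOp_zero : shiftOp 0 = 1 := ext_impulse fun i => by simp [shiftOp_impulse]

theorem star_shiftOp_mul (m : ℤ) : star (shiftOp m) * shiftOp m = 1 := star_reindex_mul_reindex _ _

theorem star_shiftOp (m : ℤ) : star (shiftOp m) = shiftOp (-m) := by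
  have h : shiftOp m * shiftOp (-m) = 1 := by rw [← shiftOp_add, add_neg_cancel, shiftOp_zero]
  calc star (shiftOp m) = star (shiftOp m) * (shiftOp m * shiftOp (-m)) := by rw [h, mul_one]
    _ = _ := by rw [← mul_assoc, star_shiftOp_mul, one_mul]

theorem shiftOp_apply (m : ℤ) (x : SqSummable) (k : ℤ) : shiftOp m x k = x (k - m) := by
  have h : star (shiftOp (-m)) = shiftOp m := by rw [star_shiftOp, neg_neg]
  rw [← h, shiftOp, star_reindex_apply]
  rw [sub_eq_neg_add]

/-- Convolution with a finitely supported sequence, as an operator on `ℓ²(ℤ)`. -/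
def convOp : Filt →ₐ[ℂ] (SqSummable →L[ℂ] SqSummable) :=
  AddMonoidAlgebra.lift ℂ _ ℤ
    { toFun := fun m => shiftOp m.toAdd
      map_one' := shiftOp_zero
      map_mul' := fun m k => shiftOp_add m.toAdd k.toAdd }

theorem convOp_single (m : ℤ) (c : ℂ) : convOp (.single m c) = c • shiftOp m :=
  AddMonoidAlgebra.lift_single _ _ _

/-- The Fourier transform of a finitely supported sequence. -/
def symbol (ξ : ℝ) : Filt →ₐ[ℂ] ℂ :=
  AddMonoidAlgebra.lift ℂ _ ℤ
    { toFun := fun m => Complex.exp (-2 * Real.pi * Complex.I * m.toAdd * ξ)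
      map_one' := by simp
      map_mul' := fun m k => by rw [← Complex.exp_add, toAdd_mul]; congr 1; push_cast; ring }

theorem symbol_single (ξ : ℝ) (m : ℤ) (c : ℂ) :
    symbol ξ (.single m c) = c * Complex.exp (-2 * Real.pi * Complex.I * m * ξ) :=
  AddMonoidAlgebra.lift_single _ _ _

/-- Upsampling of finitely supported sequences, the substitution `z ↦ z ^ 2`. -/
def upFilt : Filt →ₐ[ℂ] Filt := AddMonoidAlgebra.mapDomainAlgHom ℂ ℂ (AddMonoidHom.mulLeft (2 : ℤ))

theorem upFilt_single (m : ℤ) (c : ℂ) : upFilt (.single m c) = .single (2 * m) c :=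
  congrArg AddMonoidAlgebra.ofCoeff Finsupp.mapDomain_single

theorem symbol_upFilt (ξ : ℝ) (f : Filt) : symbol ξ (upFilt f) = symbol (2 * ξ) f := by
  induction f using AddMonoidAlgebra.induction_linear with
  | zero => simp
  | add f g hf hg => simp [hf, hg]
  | single m c =>
    rw [upFilt_single, symbol_single, symbol_single]
    push_cast; ring_nf

/-- The noble identity of multirate filtering; for monomials it is `2 (m + k) = 2 m + 2 k` on
impulses. -/
theorem upOp_mul_convOp (f : Filt) : upOp * convOp f = convOp (upFilt f) * upOp := by
  induction f using AddMonoidAlgebra.induction_linear with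
  | zero => simp
  | add f g hf hg => simp [hf, hg, mul_add, add_mul]
  | single m c =>
    rw [upFilt_single, convOp_single, convOp_single]
    refine ext_impulse fun k => ?_
    simp only [mul_apply_eq_comp, smul_apply, map_smul,
      shiftOp_impulse, upOp_impulse, mul_add]

/-- A finitely supported sequence as an element of `ℓ²(ℤ)`. -/
def embed (f : Filt) : SqSummable := convOp f (impulse 0)

theorem embed_add (f g : Filt) : embed (f + g) = embed f + embed g := by simp [embed]

theorem embed_single (m : ℤ) (c : ℂ) : embed (.single m c) = c • impulse m := by
  rw [embed, convOp_single, smul_apply, shiftOp_impulse, add_zero]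

theorem embed_apply (f : Filt) (k : ℤ) : embed f k = f.coeff k := by
  induction f using AddMonoidAlgebra.induction_linear with
  | zero => simp [embed]
  | add f g hf hg => simp [embed_add, hf, hg]
  | single m c =>
    rw [embed_single, ← single_eq_smul_impulse, lp.single_apply, AddMonoidAlgebra.coeff_single,
      Finsupp.single_apply, Pi.single_apply]
    simp only [eq_comm]

theorem convOp_embed (f g : Filt) : convOp f (embed g) = embed (f * g) := by
  simp [embed]

theorem upOp_embed (f : Filt) : upOp (embed f) = embed (upFilt f) := by
  have := congrArg (fun A => A (impulse 0)) (upOp_mul_convOp f)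
  simp only [mul_apply_eq_comp, upOp_impulse, mul_zero] at this
  exact this

/-- Finitely supported sequences are dense, so closed conditions need checking only on Laurent
polynomials, where the integral formulas involve continuous functions. -/
theorem isClosed_of_embed {P : SqSummable → Prop} (hP : IsClosed {x | P x})
    (h : ∀ f, P (embed f)) (x : SqSummable) : P x := by
  have hx := lp.hasSum_single (E := fun _ : ℤ => ℂ) (p := 2) (by norm_num) x
  refine hP.mem_of_tendsto hx (Filter.Eventually.of_forall fun s => ?_)
  have : ∑ i ∈ s, (lp.single 2 i (x i) : SqSummable) = embed (∑ i ∈ s, .single i (x i)) := by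
    simp only [embed, map_sum, sum_apply, single_eq_smul_impulse]
    exact Finset.sum_congr rfl fun i _ => (embed_single i (x i)).symm
  show P _
  rw [this]; exact h _

theorem continuous_symbol (f : Filt) : Continuous fun ξ => symbol ξ f := by
  induction f using AddMonoidAlgebra.induction_linear with
  | zero => simpa using continuous_const
  | add f g hf hg => simp only [map_add]; exact hf.add hg
  | single m c => simp only [symbol_single]; fun_prop

theorem integral_exp_int_mul (m : ℤ) :
    ∫ ξ in (-1 / 2 : ℝ)..(1 / 2), Complex.exp (2 * Real.pi * Complex.I * m * ξ)
      = if m = 0 then 1 else 0 := by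
  split_ifs with h
  · subst h; simp; norm_num
  · have hc : (2 * Real.pi * Complex.I * m : ℂ) ≠ 0 := by
      simp [h, Real.pi_ne_zero]
    rw [integral_exp_mul_complex hc, div_eq_zero_iff]
    left
    rw [sub_eq_zero, Complex.exp_eq_exp_iff_exists_int]
    exact ⟨m, by push_cast; ring⟩

/-- Parseval's identity: sesquilinearity reduces it to the orthogonality of exponentials. -/
theorem inner_embed (f g : Filt) : inner ℂ (embed f) (embed g)
    = ∫ ξ in (-1 / 2 : ℝ)..(1 / 2), conj (symbol ξ f) * symbol ξ g := by
  have hi : ∀ f g : Filt, IntervalIntegrable (fun ξ => conj (symbol ξ f) * symbol ξ g)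
      MeasureTheory.volume (-1 / 2 : ℝ) (1 / 2) := fun f g =>
    ((Complex.continuous_conj.comp (continuous_symbol f)).mul
      (continuous_symbol g)).intervalIntegrable _ _
  induction f using AddMonoidAlgebra.induction_linear with
  | zero => simp [embed]
  | add f₁ f₂ h₁ h₂ =>
    rw [embed_add, inner_add_left, h₁, h₂, ← intervalIntegral.integral_add (hi _ _) (hi _ _)]
    simp only [map_add, add_mul]
  | single m c =>
    induction g using AddMonoidAlgebra.induction_linear with
    | zero => simp [embed]
    | add g₁ g₂ h₁ h₂ =>
      rw [embed_add, inner_add_right, h₁, h₂, ← intervalIntegral.integral_add (hi _ _) (hi _ _)]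
      simp only [map_add, mul_add]
    | single k d =>
      have e : ∀ ξ : ℝ, conj (symbol ξ (.single m c)) * symbol ξ (.single k d)
          = (conj c * d) * Complex.exp (2 * Real.pi * Complex.I * ((m - k : ℤ) : ℂ) * ξ) := by
        intro ξ
        rw [symbol_single, symbol_single, map_mul, ← Complex.exp_conj]
        simp only [map_mul, map_neg, Complex.conj_I, Complex.conj_ofReal, map_ofNat, map_intCast]
        rw [mul_mul_mul_comm, ← Complex.exp_add]
        congr 2; push_cast; ring
      simp only [e]
      rw [intervalIntegral.integral_const_mul, integral_exp_int_mul, embed_single, embed_single,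
        inner_smul_left, inner_smul_right, (orthonormal_iff_ite.1 orthonormal_impulse) m k]
      simp only [sub_eq_zero, mul_assoc]

theorem norm_sq_embed (f : Filt) :
    ‖embed f‖ ^ 2 = ∫ ξ in (-1 / 2 : ℝ)..(1 / 2), ‖symbol ξ f‖ ^ 2 := by
  have h := inner_embed f f
  rw [inner_self_eq_norm_sq_to_K] at h
  have e : ∀ ξ, conj (symbol ξ f) * symbol ξ f = ((‖symbol ξ f‖ ^ 2 : ℝ) : ℂ) := fun ξ => by
    rw [mul_comm, Complex.mul_conj, Complex.normSq_eq_norm_sq]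
  simp only [e, intervalIntegral.integral_ofReal] at h
  refine Complex.ofReal_injective ?_
  rw [← h]; push_cast; rfl

/-- By Parseval, convolution is multiplication by the symbol on a dense subspace. -/
theorem norm_convOp_le (f : Filt) {C : ℝ} (hC : ∀ ξ, ‖symbol ξ f‖ ≤ C) : ‖convOp f‖ ≤ C := by
  have hC0 : 0 ≤ C := (norm_nonneg _).trans (hC 0)
  refine (convOp f).opNorm_le_bound hC0 fun x => ?_
  refine isClosed_of_embed (P := fun x => ‖convOp f x‖ ≤ C * ‖x‖)
    (isClosed_le (by fun_prop) (by fun_prop)) (fun g => ?_) x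
  refine le_of_sq_le_sq ?_ (by positivity)
  rw [convOp_embed, mul_pow, norm_sq_embed, norm_sq_embed, ← intervalIntegral.integral_const_mul]
  have c1 := continuous_symbol (f * g)
  have c2 := continuous_symbol g
  refine intervalIntegral.integral_mono_on (by norm_num)
    (Continuous.intervalIntegrable (by fun_prop) _ _)
    (Continuous.intervalIntegrable (by fun_prop) _ _) fun ξ _ => ?_
  rw [map_mul, norm_mul, mul_pow]
  gcongr
  exact hC ξ

end LaurentOperators

/-! ### Synthesis operators of finitely supported filters -/

section FilterOperators

open ComplexConjugate

theorem symbol_single_one (ξ : ℝ) : symbol ξ (.single 1 1) = unitExp (-ξ) := by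
  rw [symbol_single, unitExp, one_mul]; congr 1; push_cast; ring

theorem convOp_single_one : convOp (.single 1 1) = shiftOp 1 := by rw [convOp_single, one_smul]

theorem norm_one_sub_unitExp_neg (ξ : ℝ) : ‖1 - unitExp (-ξ)‖ = ‖1 - unitExp ξ‖ := by
  have h : unitExp (-ξ) = conj (unitExp ξ) := by
    rw [unitExp, unitExp, ← Complex.exp_conj]
    simp only [map_mul, Complex.conj_I, Complex.conj_ofReal, map_ofNat]
    congr 1; push_cast; ring
  rw [h, ← Complex.norm_conj (1 - unitExp ξ), map_sub, map_one]

/-- Division by `1 - z` with remainder. -/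
theorem exists_eq_add_one_sub_mul (f : Filt) :
    ∃ q : Filt, f = algebraMap ℂ Filt (symbol 0 f) + (1 - .single 1 1) * q := by
  -- Every power of `z`, negative ones included, is congruent to 1 modulo `1 - z`.
  have mono : ∀ m : ℤ, ∃ q : Filt, (.single m 1 : Filt) = 1 + (1 - .single 1 1) * q := by
    intro m
    induction m using Int.induction_on with
    | zero => exact ⟨0, by rw [mul_zero, add_zero]; rfl⟩
    | succ i ih =>
      obtain ⟨q, hq⟩ := ih
      have : (.single (i + 1) 1 : Filt) = .single i 1 * .single 1 1 := by
        rw [AddMonoidAlgebra.single_mul_single, mul_one]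
      refine ⟨q * .single 1 1 - 1, ?_⟩
      rw [this, hq]; ring
    | pred i ih =>
      obtain ⟨q, hq⟩ := ih
      have : (.single (-i - 1) 1 : Filt) = .single (-i) 1 * .single (-1) 1 := by
        rw [AddMonoidAlgebra.single_mul_single, mul_one, sub_eq_add_neg]
      have h1 : (.single 1 1 : Filt) * .single (-1) 1 = 1 := by
        rw [AddMonoidAlgebra.single_mul_single, mul_one, AddMonoidAlgebra.one_def]; rfl
      refine ⟨q * .single (-1) 1 + .single (-1) 1, ?_⟩
      rw [this, hq]; linear_combination h1
  induction f using AddMonoidAlgebra.induction_linear with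
  | zero => exact ⟨0, by simp⟩
  | add f g hf hg =>
    obtain ⟨q, hq⟩ := hf
    obtain ⟨r, hr⟩ := hg
    refine ⟨q + r, ?_⟩
    rw [map_add, map_add]
    linear_combination hq + hr
  | single m c =>
    obtain ⟨q, hq⟩ := mono m
    refine ⟨c • q, ?_⟩
    have h1 : (.single m c : Filt) = c • .single m 1 := by
      rw [AddMonoidAlgebra.smul_single, smul_eq_mul, mul_one]
    have h2 : symbol 0 (.single m c) = c := by rw [symbol_single]; simp
    rw [h2, h1, hq, smul_add, Algebra.algebraMap_eq_smul_one, mul_smul_comm]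

theorem exists_norm_symbol_le (f : Filt) : ∃ K : ℝ, 0 ≤ K ∧ ∀ ξ, ‖symbol ξ f‖ ≤ K := by
  induction f using AddMonoidAlgebra.induction_linear with
  | zero => exact ⟨0, le_rfl, fun ξ => by simp⟩
  | add f g hf hg =>
    obtain ⟨K, hK0, hK⟩ := hf
    obtain ⟨L, hL0, hL⟩ := hg
    exact ⟨K + L, by positivity, fun ξ => by
      rw [map_add]; exact (norm_add_le _ _).trans (add_le_add (hK ξ) (hL ξ))⟩
  | single m c =>
    refine ⟨‖c‖, norm_nonneg _, fun ξ => ?_⟩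
    have : (-2 * Real.pi * Complex.I * m * ξ : ℂ)
        = ((-2 * Real.pi * m * ξ : ℝ) : ℂ) * Complex.I := by push_cast; ring
    rw [symbol_single, norm_mul, this, Complex.norm_exp_ofReal_mul_I, mul_one]

theorem exists_star_convOp_eq (f : Filt) : ∃ f' : Filt, star (convOp f) = convOp f' ∧
    ∀ ξ, symbol ξ f' = conj (symbol ξ f) := by
  induction f using AddMonoidAlgebra.induction_linear with
  | zero => exact ⟨0, by simp, by simp⟩
  | add f g hf hg =>
    obtain ⟨f', hf', hf''⟩ := hf
    obtain ⟨g', hg', hg''⟩ := hg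
    exact ⟨f' + g', by rw [map_add, star_add, hf', hg', map_add], fun ξ => by
      rw [map_add, map_add, map_add, hf'', hg'']⟩
  | single m c =>
    refine ⟨.single (-m) (conj c), ?_, fun ξ => ?_⟩
    · rw [convOp_single, convOp_single, star_smul, star_shiftOp]; rfl
    · rw [symbol_single, symbol_single, map_mul, ← Complex.exp_conj]
      simp only [map_mul, map_neg, Complex.conj_I, Complex.conj_ofReal, map_ofNat, map_intCast]
      congr 2; push_cast; ring

/-- Compression by upsampling keeps the even coefficients and kills the odd ones; on symbols this is
averaging over `ξ` and `ξ + 1/2`. -/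
theorem star_upOp_mul_convOp_mul_upOp (f : Filt) : ∃ d : Filt,
    star upOp * convOp f * upOp = convOp d ∧
    ∀ ξ, symbol (2 * ξ) d = (symbol ξ f + symbol (ξ + 1 / 2) f) / 2 := by
  induction f using AddMonoidAlgebra.induction_linear with
  | zero => exact ⟨0, by simp, by simp⟩
  | add f g hf hg =>
    obtain ⟨f', hf', hf''⟩ := hf
    obtain ⟨g', hg', hg''⟩ := hg
    refine ⟨f' + g', by rw [map_add, mul_add, add_mul, hf', hg', map_add], fun ξ => ?_⟩
    rw [map_add, map_add, map_add, hf'', hg'']; ring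
  | single m c =>
    rcases Int.even_or_odd' m with ⟨k, rfl | rfl⟩
    · refine ⟨.single k c, ?_, fun ξ => ?_⟩
      · rw [← upFilt_single, mul_assoc, ← upOp_mul_convOp, ← mul_assoc]
        unfold upOp
        rw [star_reindex_mul_reindex, one_mul]
      · simp only [symbol_single]
        have : Complex.exp (-2 * Real.pi * Complex.I * ((2 * k : ℤ) : ℂ) * ((ξ + 1 / 2 : ℝ) : ℂ))
            = Complex.exp (-2 * Real.pi * Complex.I * ((2 * k : ℤ) : ℂ) * ξ) := by
          rw [Complex.exp_eq_exp_iff_exists_int]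
          exact ⟨-k, by push_cast; ring⟩
        rw [this, ← two_mul, mul_div_cancel_left₀ _ two_ne_zero]
        push_cast; ring_nf
    · refine ⟨0, ?_, fun ξ => ?_⟩
      · rw [map_zero, convOp_single]
        refine ext_impulse fun i => ?_
        simp only [mul_apply_eq_comp, upOp_impulse, smul_apply, shiftOp_impulse, map_smul]
        have : star upOp (impulse (2 * k + 1 + 2 * i)) = 0 := by
          ext l
          rw [upOp, star_reindex_apply, impulse, lp.single_apply, Pi.single_apply, if_neg (by omega)]
          rfl
        rw [this, smul_zero]; rfl
      · simp only [symbol_single, map_zero]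
        have : Complex.exp
            (-2 * Real.pi * Complex.I * ((2 * k + 1 : ℤ) : ℂ) * ((ξ + 1 / 2 : ℝ) : ℂ))
            = -Complex.exp (-2 * Real.pi * Complex.I * ((2 * k + 1 : ℤ) : ℂ) * ξ) := by
          rw [← Complex.exp_sub_pi_mul_I, Complex.exp_eq_exp_iff_exists_int]
          exact ⟨-k, by push_cast; ring⟩
        rw [this]; ring

/-- The synthesis operator `c ↦ f * U c` of a finitely supported filter. -/
def synth (f : Filt) : SqSummable →L[ℂ] SqSummable := convOp f * upOp

/-- The iterated filter `f * U f * ⋯ * U^{j-1} f`. -/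
def iterFilt (f : Filt) : ℕ → Filt
  | 0 => 1
  | j + 1 => iterFilt f j * upFilt^[j] f

theorem upOp_pow_mul_convOp (j : ℕ) (f : Filt) :
    upOp ^ j * convOp f = convOp (upFilt^[j] f) * upOp ^ j := by
  induction j generalizing f with
  | zero => simp
  | succ j ih =>
    rw [pow_succ, mul_assoc, upOp_mul_convOp, ← mul_assoc, ih, Function.iterate_succ_apply,
      mul_assoc]

theorem synth_pow (f : Filt) (j : ℕ) : synth f ^ j = convOp (iterFilt f j) * upOp ^ j := by
  induction j with
  | zero => simp [iterFilt]
  | succ j ih =>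
    rw [pow_succ, ih, synth, iterFilt, map_mul, pow_succ]
    calc convOp (iterFilt f j) * upOp ^ j * (convOp f * upOp)
        = convOp (iterFilt f j) * (upOp ^ j * convOp f) * upOp := by simp only [mul_assoc]
      _ = _ := by rw [upOp_pow_mul_convOp]; simp only [mul_assoc]

theorem symbol_iterate_upFilt (j : ℕ) (f : Filt) (ξ : ℝ) :
    symbol ξ (upFilt^[j] f) = symbol (2 ^ j * ξ) f := by
  induction j generalizing f with
  | zero => simp
  | succ j ih =>
    rw [Function.iterate_succ_apply, ih, symbol_upFilt, pow_succ']
    ring_nf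

theorem symbol_iterFilt (f : Filt) (j : ℕ) (ξ : ℝ) :
    symbol ξ (iterFilt f j) = ∏ k ∈ Finset.range j, symbol (2 ^ k * ξ) f := by
  induction j with
  | zero => simp [iterFilt]
  | succ j ih => rw [iterFilt, map_mul, ih, symbol_iterate_upFilt, Finset.prod_range_succ]

/-- By the noble identity the operator is a contraction `U^j` followed by convolution with `(1 - z)
h_j`, so its norm is at most a bound for that symbol. -/
theorem norm_one_sub_shiftOp_mul_synth_pow_le (f : Filt) (j : ℕ) {C : ℝ}
    (hC : ∀ ξ, ‖1 - unitExp ξ‖ * ‖∏ k ∈ Finset.range j, symbol (2 ^ k * ξ) f‖ ≤ C) :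
    ‖(1 - shiftOp 1) * synth f ^ j‖ ≤ C := by
  have e : (1 - shiftOp 1) * synth f ^ j
      = convOp ((1 - .single 1 1) * iterFilt f j) * upOp ^ j := by
    rw [synth_pow, map_mul, map_sub, map_one, convOp_single_one, mul_assoc]
  have hC0 : 0 ≤ C := le_trans (by positivity) (hC 0)
  have hU : ‖upOp ^ j‖ ≤ 1 := by
    rcases Nat.eq_zero_or_pos j with rfl | hj
    · rw [pow_zero]; exact ContinuousLinearMap.norm_id_le
    · exact (norm_pow_le' _ hj).trans (pow_le_one₀ (norm_nonneg _) norm_upOp_le)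
  rw [e]
  refine (norm_mul_le _ _).trans ?_
  calc _ ≤ C * 1 := by
        gcongr
        refine norm_convOp_le _ fun ξ => ?_
        rw [map_mul, map_sub, map_one, symbol_single_one, symbol_iterFilt, norm_mul,
          norm_one_sub_unitExp_neg]
        exact hC ξ
    _ = C := mul_one C

theorem convOp_mul_comm (f g : Filt) : convOp f * convOp g = convOp g * convOp f := by
  rw [← map_mul, mul_comm, map_mul]

theorem synth_mul_shiftOp (f : Filt) : synth f * shiftOp 1 = shiftOp 1 ^ 2 * synth f := by
  have h : (upFilt (.single 1 1) : Filt) = .single 1 1 * .single 1 1 := by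
    rw [upFilt_single, AddMonoidAlgebra.single_mul_single, mul_one, mul_one]; rfl
  rw [synth, ← convOp_single_one, mul_assoc, upOp_mul_convOp, h, ← mul_assoc, convOp_mul_comm,
    map_mul, sq, mul_assoc]

/-- For a low-pass filter `S*S - 1` factors through `1 - T`. -/
theorem exists_star_synth_mul_synth_eq (f : Filt) (h0 : ‖symbol 0 f‖ ^ 2 = 2)
    (h1 : symbol (1 / 2) f = 0) :
    ∃ Q, star (synth f) * synth f = 1 + Q * (1 - shiftOp 1) := by
  obtain ⟨f', hf', hf''⟩ := exists_star_convOp_eq f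
  obtain ⟨d, hd, hd'⟩ := star_upOp_mul_convOp_mul_upOp (f' * f)
  obtain ⟨q, hq⟩ := exists_eq_add_one_sub_mul d
  -- The averaged symbol at 0 is `(|f̂(0)|² + |f̂(1/2)|²) / 2 = (2 + 0) / 2`.
  have hd0 : symbol 0 d = 1 := by
    have := hd' 0
    rw [mul_zero, zero_add, map_mul, map_mul, h1, hf'', mul_zero, add_zero, mul_comm,
      Complex.mul_conj, Complex.normSq_eq_norm_sq, h0] at this
    rw [this]; norm_num
  refine ⟨convOp q, ?_⟩
  have : star (synth f) * synth f = convOp d := by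
    rw [← hd, synth, star_mul, hf', map_mul]; simp only [mul_assoc]
  rw [this, hq, hd0, map_one, map_add, map_one, mul_comm, map_mul, map_sub, map_one,
    convOp_single_one]

theorem exists_synth_eq_one_sub_mul (f : Filt) (h0 : symbol 0 f = 0) :
    ∃ W, synth f = (1 - shiftOp 1) * W := by
  obtain ⟨q, hq⟩ := exists_eq_add_one_sub_mul f
  rw [h0, map_zero, zero_add] at hq
  refine ⟨synth q, ?_⟩
  rw [synth, hq, map_mul, map_sub, map_one, convOp_single_one, synth, mul_assoc]

/-- An invariant sequence is constant, and only the zero constant is square summable. -/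
theorem eq_zero_of_shiftOp_eq (x : SqSummable) (hx : shiftOp 1 x = x) : x = 0 := by
  have h1 : ∀ k, x (k + 1) = x k := fun k => by
    have := congrArg (fun y : SqSummable => y (k + 1)) hx
    simp only [shiftOp_apply, add_sub_cancel_right] at this
    exact this.symm
  have h2 : ∀ k, x k = x 0 := fun k => by
    induction k using Int.induction_on with
    | zero => rfl
    | succ i ih => rw [h1, ih]
    | pred i ih => rw [← ih, ← h1 (-i - 1), sub_add_cancel]
  have h3 := (lp.hasSum_norm (p := 2) (by norm_num) x).summable
  have h4 : Summable fun _ : ℤ => ‖x 0‖ ^ (2 : ENNReal).toReal := by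
    refine h3.congr fun k => by rw [h2 k]
  rw [summable_const_iff] at h4
  ext k
  rw [h2 k]
  simpa using h4

theorem symbol_add_one (ξ : ℝ) (f : Filt) : symbol (ξ + 1) f = symbol ξ f := by
  induction f using AddMonoidAlgebra.induction_linear with
  | zero => simp
  | add f g hf hg => simp only [map_add, hf, hg]
  | single m c =>
    rw [symbol_single, symbol_single]
    congr 1
    rw [Complex.exp_eq_exp_iff_exists_int]
    exact ⟨-m, by push_cast; ring⟩

theorem integral_norm_sq_symbol_add_half (f : Filt) :
    ∫ ξ in (-1 / 2 : ℝ)..(1 / 2), ‖symbol (ξ + 1 / 2) f‖ ^ 2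
      = ∫ ξ in (-1 / 2 : ℝ)..(1 / 2), ‖symbol ξ f‖ ^ 2 := by
  rw [intervalIntegral.integral_comp_add_right (fun ξ => ‖symbol ξ f‖ ^ 2)]
  have hper : Function.Periodic (fun ξ => ‖symbol ξ f‖ ^ 2) 1 := fun ξ => by
    simp only [symbol_add_one]
  have := hper.intervalIntegral_add_eq 0 (-1 / 2)
  convert this using 2 <;> norm_num

/-- The analysis operator in the Fourier domain. -/
theorem norm_sq_star_synth_embed (f x : Filt) : ‖star (synth f) (embed x)‖ ^ 2
    = ∫ ξ in (-1 / 2 : ℝ)..(1 / 2), ‖(conj (symbol ξ f) * symbol ξ x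
      + conj (symbol (ξ + 1 / 2) f) * symbol (ξ + 1 / 2) x) / 2‖ ^ 2 := by
  obtain ⟨f', hf', hf''⟩ := exists_star_convOp_eq f
  obtain ⟨d, hd, hd'⟩ := star_upOp_mul_convOp_mul_upOp (f' * x)
  have h1 : star (synth f) (embed x) = embed d := by
    have h2 : embed d = star upOp (convOp (f' * x) (upOp (impulse 0))) := by
      rw [embed, ← hd]; rfl
    rw [h2, upOp_impulse, mul_zero, synth, star_mul, hf', mul_apply_eq_comp, convOp_embed]
    rfl
  -- Upsampling is isometric and replaces the symbol of `d` at `ξ` by its value at `2 ξ`, where the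
  -- averaging formula holds.
  have h3 : ‖embed d‖ = ‖embed (upFilt d)‖ := by
    rw [← upOp_embed]; exact (norm_reindex _ _ _).symm
  rw [h1, h3, norm_sq_embed]
  refine intervalIntegral.integral_congr fun ξ _ => ?_
  simp only [symbol_upFilt, hd', map_mul, hf'']

/-- An expanding square matrix is injective, hence onto: `c = M v` with `‖v‖ ≤ ‖c‖`. Then `‖c‖² =
⟨M* c, v⟩ ≤ ‖M* c‖ ‖c‖`. -/
theorem IsExpanding.conjTranspose {M : Matrix (Fin 2) (Fin 2) ℂ} (hM : IsExpanding M) (a b : ℂ) :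
    ‖a‖ ^ 2 + ‖b‖ ^ 2 ≤ ‖conj (M 0 0) * a + conj (M 1 0) * b‖ ^ 2
      + ‖conj (M 0 1) * a + conj (M 1 1) * b‖ ^ 2 := by
  have hinj : Function.Injective (Matrix.toEuclideanLin M) := by
    rw [injective_iff_map_eq_zero]
    intro c hc
    have := hM c
    rw [hc, norm_zero] at this
    exact norm_le_zero_iff.1 this
  set c : EuclideanSpace ℂ (Fin 2) := !₂[a, b] with hc
  obtain ⟨v, hv⟩ := LinearMap.injective_iff_surjective.1 hinj c
  have h1 : ‖c‖ ^ 2 ≤ ‖Matrix.toEuclideanLin M.conjTranspose c‖ * ‖c‖ := by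
    have h2 : ((‖c‖ ^ 2 : ℝ) : ℂ) = inner ℂ (Matrix.toEuclideanLin M.conjTranspose c) v := by
      rw [Matrix.toEuclideanLin_conjTranspose_eq_adjoint, LinearMap.adjoint_inner_left, hv,
        inner_self_eq_norm_sq_to_K]
      push_cast; rfl
    have h3 := congrArg norm h2
    rw [Complex.norm_real, Real.norm_of_nonneg (by positivity)] at h3
    rw [h3]
    refine (norm_inner_le_norm _ _).trans ?_
    gcongr
    have := hM v
    rwa [hv] at this
  have h4 : ‖c‖ ≤ ‖Matrix.toEuclideanLin M.conjTranspose c‖ := by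
    rcases (norm_nonneg c).eq_or_lt with h | h
    · rw [← h]; positivity
    · rw [sq] at h1; exact le_of_mul_le_mul_right h1 h
  have h5 := pow_le_pow_left₀ (norm_nonneg _) h4 2
  rw [EuclideanSpace.norm_sq_eq, EuclideanSpace.norm_sq_eq, Fin.sum_univ_two, Fin.sum_univ_two] at h5
  simpa [hc, Matrix.toLpLin_apply, Matrix.mulVec, dotProduct, Fin.sum_univ_two] using h5

/-- The adjoint of `M(ξ)` acts on the vector of values of `x̂` at `ξ` and `ξ + 1/2`; its expansion
is integrated over a period. -/
theorem norm_sq_le_of_expanding (h g : Filt)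
    (hM : ∀ᵐ ξ ∂(MeasureTheory.volume.restrict (Set.Ico (-1 / 2 : ℝ) (1 / 2))),
      IsExpanding ((1 / (Real.sqrt 2 : ℂ)) •
        !![symbol ξ g, symbol ξ h; symbol (ξ + 1 / 2) g, symbol (ξ + 1 / 2) h]))
    (x : SqSummable) : ‖x‖ ^ 2 ≤ ‖star (synth h) x‖ ^ 2 + ‖star (synth g) x‖ ^ 2 := by
  refine isClosed_of_embed
    (P := fun x => ‖x‖ ^ 2 ≤ ‖star (synth h) x‖ ^ 2 + ‖star (synth g) x‖ ^ 2)
    (isClosed_le (by fun_prop) (by fun_prop)) (fun y => ?_) x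
  have c1 := continuous_symbol h
  have c2 := continuous_symbol g
  have c3 := continuous_symbol y
  have hshift : ∀ {u : ℝ → ℂ}, Continuous u → Continuous fun ξ => u (ξ + 1 / 2) := fun hu => by
    exact hu.comp (by fun_prop)
  have c4 := hshift c1
  have c5 := hshift c2
  have c6 := hshift c3
  have hs : ∀ f : Filt, Continuous (fun ξ => ‖(conj (symbol ξ f) * symbol ξ y
      + conj (symbol (ξ + 1 / 2) f) * symbol (ξ + 1 / 2) y) / 2‖ ^ 2) := fun f => by
    have := continuous_symbol f
    have := hshift this
    have hc := Complex.continuous_conj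
    fun_prop
  have e : ‖embed y‖ ^ 2 = ∫ ξ in (-1 / 2 : ℝ)..(1 / 2),
      (‖symbol ξ y‖ ^ 2 + ‖symbol (ξ + 1 / 2) y‖ ^ 2) / 2 := by
    rw [intervalIntegral.integral_div, intervalIntegral.integral_add
      (Continuous.intervalIntegrable (by fun_prop) _ _)
      (Continuous.intervalIntegrable (by fun_prop) _ _), integral_norm_sq_symbol_add_half,
      norm_sq_embed]
    ring
  rw [e, norm_sq_star_synth_embed, norm_sq_star_synth_embed, ← intervalIntegral.integral_add
    ((hs h).intervalIntegrable _ _) ((hs g).intervalIntegrable _ _)]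
  refine intervalIntegral.integral_mono_ae_restrict (by norm_num)
    (Continuous.intervalIntegrable (by fun_prop) _ _)
    (((hs h).add (hs g)).intervalIntegrable _ _) ?_
  rw [MeasureTheory.restrict_Ico_eq_restrict_Icc] at hM
  filter_upwards [hM] with ξ hξ
  have h1 := hξ.conjTranspose (symbol ξ y) (symbol (ξ + 1 / 2) y)
  have hr : ‖((√2 : ℝ) : ℂ)⁻¹‖ ^ 2 = 1 / 2 := by
    rw [norm_inv, Complex.norm_real, Real.norm_of_nonneg (by positivity), inv_pow,
      Real.sq_sqrt (by norm_num)]; norm_num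
  -- The normalisation `1/√2` of `M` against the average over two points leaves a factor 2, matching
  -- the `1/2` in `e`.
  have key : ∀ u v a b : ℂ, ‖conj ((1 / (√2 : ℂ)) * u) * a + conj ((1 / (√2 : ℂ)) * v) * b‖ ^ 2
      = 2 * ‖(conj u * a + conj v * b) / 2‖ ^ 2 := by
    intro u v a b
    have : conj ((1 / (√2 : ℂ)) * u) * a + conj ((1 / (√2 : ℂ)) * v) * b
        = ((√2 : ℝ) : ℂ)⁻¹ * (conj u * a + conj v * b) := by
      simp only [map_mul, map_div₀, map_one, Complex.conj_ofReal]; ring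
    rw [this, norm_mul, mul_pow, hr, norm_div, Complex.norm_ofNat]; ring
  simp only [Matrix.smul_apply, smul_eq_mul, Matrix.of_apply, Matrix.cons_val_zero,
    Matrix.cons_val_one, Matrix.cons_val', Matrix.cons_val_fin_one] at h1
  rw [key, key] at h1
  linarith

end FilterOperators

/-! ### Sequences as Laurent polynomials, and frames from operators -/

section Identification

open ComplexConjugate

theorem hasSum_fourier_coeff (f : Filt) (ξ : ℝ) :
    HasSum (fun n : ℤ => f.coeff n * Complex.exp (-2 * Real.pi * Complex.I * n * ξ))
      (symbol ξ f) := by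
  induction f using AddMonoidAlgebra.induction_linear with
  | zero => simp
  | add f g hf hg =>
    rw [map_add]
    refine (hf.add hg).congr_fun fun n => ?_
    simp [add_mul]
  | single m c =>
    rw [symbol_single]
    convert hasSum_single (f := fun n : ℤ => (AddMonoidAlgebra.single m c : Filt).coeff n
      * Complex.exp (-2 * Real.pi * Complex.I * n * ξ)) m fun n hn => ?_
    · rw [AddMonoidAlgebra.coeff_single, Finsupp.single_eq_same]
    · rw [AddMonoidAlgebra.coeff_single, Finsupp.single_eq_of_ne hn, zero_mul]

theorem fourierTransform_coeff (f : Filt) (ξ : ℝ) : fourierTransform f.coeff ξ = symbol ξ f :=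
  (hasSum_fourier_coeff f ξ).tsum_eq

theorem hasSum_conv_coeff (f g : Filt) (k : ℤ) :
    HasSum (fun n : ℤ => g.coeff n * f.coeff (k - n)) ((f * g).coeff k) := by
  induction g using AddMonoidAlgebra.induction_linear with
  | zero => simp
  | add g₁ g₂ h₁ h₂ =>
    rw [mul_add, AddMonoidAlgebra.coeff_add (f * g₁), Finsupp.add_apply]
    refine (h₁.add h₂).congr_fun fun n => ?_
    simp [add_mul]
  | single m c =>
    have e : (f * .single m c).coeff k = c * f.coeff (k - m) := by
      rw [← embed_apply, mul_comm, ← convOp_embed, convOp_single, smul_apply]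
      change c * (shiftOp m (embed f)) k = _
      rw [shiftOp_apply, embed_apply]
    rw [e]
    convert hasSum_single (f := fun n : ℤ => (AddMonoidAlgebra.single m c : Filt).coeff n
      * f.coeff (k - n)) m fun n hn => ?_
    · rw [AddMonoidAlgebra.coeff_single, Finsupp.single_eq_same]
    · rw [AddMonoidAlgebra.coeff_single, Finsupp.single_eq_of_ne hn, zero_mul]

theorem conv_coeff (f g : Filt) : conv f.coeff g.coeff = (f * g).coeff :=
  funext fun k => (hasSum_conv_coeff f g k).tsum_eq

theorem upsample_coeff (f : Filt) : upsample f.coeff = (upFilt f).coeff := by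
  funext n
  induction f using AddMonoidAlgebra.induction_linear with
  | zero => simp [upsample]
  | add f g hf hg =>
    rw [map_add, AddMonoidAlgebra.coeff_add, AddMonoidAlgebra.coeff_add, Finsupp.add_apply, ← hf,
      ← hg]
    simp only [upsample, Finsupp.add_apply]
    split_ifs <;> simp
  | single m c =>
    rw [upFilt_single]
    simp only [upsample, AddMonoidAlgebra.coeff_single, Finsupp.single_apply]
    split_ifs <;> first | rfl | omega

theorem iterate_upsample_coeff (f : Filt) (j : ℕ) :
    upsample^[j] f.coeff = (upFilt^[j] f).coeff := by
  induction j generalizing f with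
  | zero => rfl
  | succ j ih => rw [Function.iterate_succ_apply, Function.iterate_succ_apply, upsample_coeff, ih]

theorem iteratedLowPass_coeff (f : Filt) (j : ℕ) :
    iteratedLowPass f.coeff j = (iterFilt f j).coeff := by
  induction j with
  | zero =>
    rw [iterFilt, AddMonoidAlgebra.one_def, AddMonoidAlgebra.coeff_single,
      Finsupp.single_eq_pi_single]
    rfl
  | succ j ih => rw [iteratedLowPass, ih, iterate_upsample_coeff, conv_coeff, iterFilt]

theorem iteratedHighPass_coeff (f g : Filt) (j : ℕ) :
    iteratedHighPass f.coeff g.coeff (j + 1) = (iterFilt f j * upFilt^[j] g).coeff := by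
  rw [iteratedHighPass, Nat.add_sub_cancel, iteratedLowPass_coeff, iterate_upsample_coeff,
    conv_coeff]

theorem upOp_pow_impulse (j : ℕ) (k : ℤ) : (upOp ^ j) (impulse k) = impulse (2 ^ j * k) := by
  induction j generalizing k with
  | zero => simp
  | succ j ih => rw [pow_succ, mul_apply_eq_comp, upOp_impulse, ih, pow_succ, mul_assoc]

/-- The frame elements are the images of the impulses under the iterated synthesis operators. -/
theorem synth_pow_mul_synth_impulse (f g : Filt) (j : ℕ) (k : ℤ) :
    ((synth f ^ j * synth g) (impulse k) : ℤ → ℂ)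
      = translate (2 ^ (j + 1) * k) (iteratedHighPass f.coeff g.coeff (j + 1)) := by
  have e : synth f ^ j * synth g = convOp (iterFilt f j * upFilt^[j] g) * upOp ^ (j + 1) := by
    rw [synth_pow, synth, map_mul, pow_succ]
    calc convOp (iterFilt f j) * upOp ^ j * (convOp g * upOp)
        = convOp (iterFilt f j) * (upOp ^ j * convOp g) * upOp := by simp only [mul_assoc]
      _ = _ := by rw [upOp_pow_mul_convOp]; simp only [mul_assoc]
  have e2 : (impulse (2 ^ (j + 1) * k)) = embed (.single (2 ^ (j + 1) * k) 1) := by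
    rw [embed_single, one_smul]
  funext l
  rw [iteratedHighPass_coeff, translate, e, mul_apply_eq_comp, upOp_pow_impulse, e2, convOp_embed,
    mul_comm, ← convOp_embed, convOp_single, one_smul, shiftOp_apply, embed_apply]

/-- Frame bounds for the operators `A j` are frame bounds for the family `A j (impulse k)`. -/
theorem isFrameWithBounds_of_operators (A : ℕ → SqSummable →L[ℂ] SqSummable) {a B : ℝ} (ha : 0 < a)
    (haB : a ≤ B)
    (hA : ∀ x, Summable (fun j => ‖star (A j) x‖ ^ 2) ∧ a * ‖x‖ ^ 2 ≤ ∑' j, ‖star (A j) x‖ ^ 2 ∧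
      ∑' j, ‖star (A j) x‖ ^ 2 ≤ B * ‖x‖ ^ 2) :
    IsFrameWithBounds (fun i : ℕ × ℤ => A i.1 (impulse i.2)) a B := by
  refine ⟨ha, haB, fun x => ?_⟩
  obtain ⟨hsum, hlow, hup⟩ := hA x
  have hcoeff : ∀ j k, ‖inner ℂ x (A j (impulse k))‖ = ‖star (A j) x k‖ := fun j k => by
    rw [← inner_impulse_left, ContinuousLinearMap.star_eq_adjoint,
      ContinuousLinearMap.adjoint_inner_right, norm_inner_symm]
  have hinner : ∀ j, HasSum (fun k => ‖inner ℂ x (A j (impulse k))‖ ^ 2) (‖star (A j) x‖ ^ 2) := by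
    intro j
    have := lp.hasSum_norm (p := 2) (by norm_num) (star (A j) x)
    simp only [ENNReal.toReal_ofNat, Real.rpow_ofNat] at this
    simpa only [hcoeff] using this
  have hs : Summable fun i : ℕ × ℤ => ‖inner ℂ x (A i.1 (impulse i.2))‖ ^ 2 := by
    rw [summable_prod_of_nonneg fun _ => by positivity]
    exact ⟨fun j => (hinner j).summable, hsum.congr fun j => ((hinner j).tsum_eq).symm⟩
  have ht : ∑' i : ℕ × ℤ, ‖inner ℂ x (A i.1 (impulse i.2))‖ ^ 2 = ∑' j, ‖star (A j) x‖ ^ 2 := by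
    rw [hs.tsum_prod]
    exact tsum_congr fun j => (hinner j).tsum_eq
  exact ⟨hs, by rw [ht]; exact hlow, by rw [ht]; exact hup⟩

theorem norm_exp_two_pi_int_mul (m : ℤ) (ξ : ℝ) :
    ‖Complex.exp (-2 * Real.pi * Complex.I * m * ξ)‖ = 1 := by
  have : (-2 * Real.pi * Complex.I * m * ξ : ℂ)
      = ((-2 * Real.pi * m * ξ : ℝ) : ℂ) * Complex.I := by push_cast; ring
  rw [this, Complex.norm_exp_ofReal_mul_I]

/-- Fourier inversion for absolutely summable sequences. -/
theorem integral_mul_fourierTransform (x : ℤ → ℂ) (hx : Summable fun n => ‖x n‖) (k : ℤ) :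
    ∫ ξ in (-1 / 2 : ℝ)..(1 / 2), conj (symbol ξ (.single k 1)) * fourierTransform x ξ = x k := by
  have c1 := continuous_symbol (.single k 1)
  have hc := Complex.continuous_conj
  set u : ℤ → C(ℝ, ℂ) := fun n =>
    ⟨fun ξ => conj (symbol ξ (.single k 1)) * symbol ξ (.single n (x n)), by
      have := continuous_symbol (.single n (x n))
      fun_prop⟩ with hu
  have hn : ∀ n ξ, ‖u n ξ‖ = ‖x n‖ := fun n ξ => by
    simp only [hu, ContinuousMap.coe_mk, symbol_single, one_mul, norm_mul, Complex.norm_conj,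
      norm_exp_two_pi_int_mul, mul_one]
  have hs : Summable fun n => ‖(u n).restrict
      (⟨Set.uIcc (-1 / 2 : ℝ) (1 / 2), isCompact_uIcc⟩ : TopologicalSpace.Compacts ℝ)‖ := by
    refine Summable.of_nonneg_of_le (fun _ => norm_nonneg _) (fun n => ?_) hx
    refine (ContinuousMap.norm_le _ (norm_nonneg _)).2 fun ξ => ?_
    exact (hn n ξ).le
  have h := intervalIntegral.hasSum_intervalIntegral_of_summable_norm hs
  have h1 : ∀ n, ∫ ξ in (-1 / 2 : ℝ)..(1 / 2), u n ξ = if n = k then x k else 0 := by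
    intro n
    have := inner_embed (.single k 1) (.single n (x n))
    rw [embed_single, embed_single, one_smul, inner_smul_right,
      (orthonormal_iff_ite.1 orthonormal_impulse) k n] at this
    refine this.symm.trans ?_
    rcases eq_or_ne n k with rfl | hne
    · simp
    · rw [if_neg hne, if_neg hne.symm, mul_zero]
  simp only [h1] at h
  have h2 : ∀ ξ, ∑' n, u n ξ = conj (symbol ξ (.single k 1)) * fourierTransform x ξ := fun ξ => by
    simp only [hu, ContinuousMap.coe_mk, tsum_mul_left, fourierTransform, symbol_single]
  simp only [h2] at h
  exact h.unique (hasSum_ite_eq k (x k))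

/-- An absolutely summable sequence is determined by its Fourier transform. -/
theorem eq_coeff_of_fourierTransform_eq (x : ℤ → ℂ) (hx : Summable fun n => ‖x n‖) (f : Filt)
    (h : ∀ ξ, fourierTransform x ξ = symbol ξ f) : x = f.coeff := by
  funext k
  rw [← integral_mul_fourierTransform x hx k]
  simp only [h]
  rw [← inner_embed, embed_single, one_smul, inner_impulse_left, embed_apply]

/-- Nonvanishing of the transform at `0` entails absolute summability. -/
theorem summable_norm_of_fourierTransform_zero_ne (x : ℤ → ℂ) (h : fourierTransform x 0 ≠ 0) :
    Summable fun n => ‖x n‖ := by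
  by_contra hx
  -- A divergent `∑'` is 0 by convention, and summability in `ℂ` is absolute.
  refine h (tsum_eq_zero_of_not_summable fun hs => hx ?_)
  simpa using hs.norm

end Identification

end FilterBank

end

/-! ### Assembly of the theorem -/

open FilterBank in
theorem theorem4p3 (h g : FilterBank.SqSummable)
    (h_low : FilterBank.IsLowPass h) (g_high : FilterBank.IsHighPass g)
    (g_fin : (Function.support (g : ℤ → ℂ)).Finite)
    (n : ℕ) (n_pos : 1 ≤ n)
    (p : ℝ → ℂ) (p_trig : FilterBank.IsTrigPolynomial p) (p_zero : p 0 = 1)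
    (h_form : ∀ ξ : ℝ, FilterBank.fourierTransform h ξ =
      (Real.sqrt 2 : ℂ) * ((1 + Complex.exp (2 * Real.pi * Complex.I * ξ)) / 2) ^ n * p ξ)
    (p_est : ∃ s : ℕ, 1 ≤ s ∧
      (⨆ ξ : ℝ, ‖∏ k ∈ Finset.range s, p (2 ^ k * ξ)‖) < (2 : ℝ) ^ (((n : ℝ) - 1 / 2) * (s : ℝ)))
    (expanding : ∀ᵐ ξ ∂(MeasureTheory.volume.restrict (Set.Ico (-1 / 2 : ℝ) (1 / 2))),
      FilterBank.IsExpanding (FilterBank.modulationMatrix h g ξ)) :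
    ∃ B : ℝ, FilterBank.IsStableWithBounds h g 1 B := by
  obtain ⟨c, hc⟩ := p_trig
  set P : Filt := .ofCoeff c with hP
  have hpP : ∀ ξ, p ξ = symbol ξ P := fun ξ => by
    rw [hc, ← (hasSum_fourier_coeff P ξ).tsum_eq]
    refine (tsum_eq_sum fun m hm => ?_).symm
    rw [Finsupp.notMem_support_iff.1 hm, zero_mul]
  -- identification of the two filters with Laurent polynomials
  obtain ⟨F, hF⟩ : ∃ F : Filt, (h : ℤ → ℂ) = F.coeff := by
    -- `E` has symbol `(1 + e^{2πiξ}) / 2`: the impulse sits at `-1` because the transform uses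
    -- `e^{-2πinξ}`. Since `ĥ(0) ≠ 0` forces absolute summability, Fourier inversion applies and `h`
    -- is finitely supported.
    set E : Filt := algebraMap ℂ Filt (1 / 2) * (1 + .single (-1) 1) with hE
    refine ⟨algebraMap ℂ Filt (Real.sqrt 2 : ℂ) * E ^ n * P,
      eq_coeff_of_fourierTransform_eq _ (summable_norm_of_fourierTransform_zero_ne _ ?_) _
        fun ξ => ?_⟩
    · rw [h_low.1]
      simp
    · rw [h_form, hpP, map_mul, map_mul, map_pow, hE, map_mul, map_add, map_one, symbol_single,
        AlgHom.commutes, AlgHom.commutes, Algebra.algebraMap_self_apply,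
        Algebra.algebraMap_self_apply, one_mul]
      have : (-2 * Real.pi * Complex.I * ((-1 : ℤ) : ℂ) * ξ : ℂ)
          = 2 * Real.pi * Complex.I * ξ := by push_cast; ring
      rw [this, one_div, inv_mul_eq_div]
  obtain ⟨G, hG⟩ : ∃ G : Filt, (g : ℤ → ℂ) = G.coeff :=
    ⟨.ofCoeff (Finsupp.ofSupportFinite g g_fin), rfl⟩
  have hsymF : ∀ ξ, symbol ξ F = (Real.sqrt 2 : ℂ) * ((1 + unitExp ξ) / 2) ^ n * p ξ := fun ξ => by
    rw [← fourierTransform_coeff, ← hF, h_form]; rfl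
  have hF0 : ‖symbol 0 F‖ ^ 2 = 2 := by
    rw [← fourierTransform_coeff, ← hF, h_low.1, Complex.norm_real,
      Real.norm_of_nonneg (by positivity), Real.sq_sqrt (by norm_num)]
  have hF1 : symbol (1 / 2) F = 0 := by rw [← fourierTransform_coeff, ← hF]; exact h_low.2
  have hG0 : symbol 0 G = 0 := by rw [← fourierTransform_coeff, ← hG]; exact g_high
  -- the decay estimate
  obtain ⟨K, hK0, hK⟩ := exists_norm_symbol_le P
  obtain ⟨q, hq⟩ := exists_eq_add_one_sub_mul P
  obtain ⟨A, hA0, hA⟩ := exists_norm_symbol_le q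
  -- Since `p 0 = 1`, division by `1 - z` leaves remainder 1, and `A` bounds the quotient.
  have hp1 : ∀ ξ, ‖p ξ‖ ≤ 1 + A * ‖1 - unitExp ξ‖ := fun ξ => by
    rw [hpP, hq, ← hpP, p_zero, map_one, map_add, map_one, map_mul, map_sub, map_one,
      symbol_single_one]
    refine (norm_add_le _ _).trans ?_
    rw [norm_one, norm_mul, norm_one_sub_unitExp_neg, mul_comm]
    gcongr
    exact hA ξ
  have hpK : ∀ ξ, ‖p ξ‖ ≤ K := fun ξ => by rw [hpP]; exact hK ξ
  obtain ⟨s, hs, hsup⟩ := p_est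
  -- Boundedness is needed because `⨆` of an unbounded real family is 0 and would bound nothing.
  have hbdd : BddAbove (Set.range fun ξ : ℝ => ‖∏ k ∈ Finset.range s, p (2 ^ k * ξ)‖) := by
    refine ⟨∏ k ∈ Finset.range s, K, ?_⟩
    rintro _ ⟨ξ, rfl⟩
    simp only [norm_prod]
    exact Finset.prod_le_prod (fun _ _ => norm_nonneg _) fun _ _ => hpK _
  obtain ⟨C, ρ, hC, hρ, hρ1, hdecay⟩ :=
    exists_norm_one_sub_mul_prod_le p hA0 hp1 hpK hs hsup fun ξ => le_ciSup hbdd ξ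
  simp only [← hsymF] at hdecay
  obtain ⟨Q, hQ⟩ := exists_star_synth_mul_synth_eq F hF0 hF1
  obtain ⟨W, hW⟩ := exists_synth_eq_one_sub_mul G hG0
  have hT : shiftOp 1 * star (shiftOp 1) = 1 := by
    rw [star_shiftOp, ← shiftOp_add, add_neg_cancel, shiftOp_zero]
  have hexp := norm_sq_le_of_expanding F G (by
    simpa only [modulationMatrix, hF, hG, fourierTransform_coeff] using expanding)
  obtain ⟨B, hB, hframe⟩ := exists_iterated_frame_bounds (synth F) (synth G) (shiftOp 1) Q W hC hρ
    hρ1 hT (star_shiftOp_mul 1) (synth_mul_shiftOp F) hQ hW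
    (fun j => norm_one_sub_shiftOp_mul_synth_pow_le F j fun ξ => hdecay j ξ)
    eq_zero_of_shiftOp_eq hexp
  refine ⟨B, fun i => (synth F ^ i.1 * synth G) (impulse i.2), fun i => ?_, ?_⟩
  · rw [hF, hG]
    exact synth_pow_mul_synth_impulse F G i.1 i.2
  · refine isFrameWithBounds_of_operators (fun j => synth F ^ j * synth G) one_pos hB fun x => ?_
    rw [one_mul]
    exact hframe x
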